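/- Let $J\subseteq\mathbb R$ be a non-empty open interval with coordinate $t$, let $\varphi:J\to(0,\infty)$ be smooth, let $p_1,p_2,p_3\in\mathbb R$, and let $(F_i,g_{F_i})$, $i=1,2,3$, be non-empty one-dimensional Riemannian manifolds. Let $M=J\times F_1\times F_2\times F_3$ carry the Lorentzian metric $$g=-dt^2\oplus\varphi^{2p_1}g_{F_1}\oplus\varphi^{2p_2}g_{F_2}\oplus\varphi^{2p_3}g_{F_3}$$ (a type (III) generalized Kasner space-time), with Levi-Civita connection $\nabla$. Let $P=\partial/\partial t$, $\pi(X)=g(X,P)$, let $\lambda_1,\lambda_2$ be non-zero real constants, and let $\overline\nabla$ be the connection $$\overline\nabla_XY=\nabla_XY+\lambda_1\pi(Y)X-\lambda_2\,g(X,Y)P.$$ Curvature is taken with the conventions $\overline R(X,Y)=\overline\nabla_X\overline\nabla_Y-\overline\nabla_Y\overline\nabla_X-\overline\nabla_{[X,Y]}$, $\overline{\mathrm{Ric}}(X,Y)=\sum_k\varepsilon_k\, g(\overline R(X,E_k)Y,E_k)$ and scalar curvature $\sum_k\varepsilon_k\overline{\mathrm{Ric}}(E_k,E_k)$, for an orthonormal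 basis $(E_k)$ with $\varepsilon_k=g(E_k,E_k)=\pm1$. Put $$\zeta=p_1+p_2+p_3,\qquad \eta=p_1^2+p_2^2+p_3^2,\qquad K=3(\lambda_1^2+\lambda_2^2-4\lambda_1\lambda_2),$$ and let $\overline S\in\mathbb R$. Then $(M,\overline\nabla)$ has constant scalar curvature $\overline S$ if and only if one of the following three conditions holds. (1) $\zeta=\eta=0$ and $\overline S=K$. (2) $\zeta=0$, $\eta\neq0$, and: the case $\overline S>K$ does not occur; if $\overline S=K$, then $\varphi=c$ on $J$ for some constant $c$; if $\overline S<K$, then for some constant $c_0$ and one choice of the sign, $\varphi(t)=c_0\,e^{\pm\sqrt{(K-\overline S)/\eta}\;t}$ for all $t\in J$. (3) $\zeta\neq0$, and $\varphi=\psi^{\frac{2\zeta}{\eta+\zeta^2}}$ on $J$ for a function $\psi:J\to(0,\infty)$ such that, with $T=\frac{9\zeta^2(\lambda_1+\lambda_2)^2}{4(\eta+\zeta^2)}+K$ and real constants $c_1,c_2$, one of the following holds for all $t\in J$: (a) $\overline S<T$ and $\psi(t)=c_1e^{\frac{\frac32(\lambda_1+\lambda_2)+\sqrt{D}}{2}t}+c_2e^{\frac{\frac32(\lambda_1+\lambda_2)-\sqrt{D}}{2}t}$,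 where $D=\frac{9(\lambda_1+\lambda_2)^2}{4}-\frac{(\overline S-K)(\eta+\zeta^2)}{\zeta^2}$; (b) $\overline S=T$ and $\psi(t)=c_1e^{\frac{3(\lambda_1+\lambda_2)}{4}t}+c_2\,t\,e^{\frac{3(\lambda_1+\lambda_2)}{4}t}$; (c) $\overline S>T$ and $\psi(t)=c_1e^{\frac34(\lambda_1+\lambda_2)t}\cos\left(\frac{\sqrt{-D}}{2}t\right)+c_2e^{\frac34(\lambda_1+\lambda_2)t}\sin\left(\frac{\sqrt{-D}}{2}t\right)$, with $D$ as in (a). -/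

import Mathlib

open scoped Manifold ContDiff

set_option maxSynthPendingDepth 3

noncomputable section

/-! ### Linear connections and their curvature in coordinates

`E` is the model vector space. A pseudo-Riemannian metric in coordinates is a map
`G : E → E →L[ℝ] E →L[ℝ] ℝ`. A linear connection is given by its Christoffel map
`Γ : E → E →L[ℝ] E →L[ℝ] E`, that is, `(∇_X Y)(y) = DY(y)(X(y)) + Γ(y)(X(y), Y(y))`. -/

section Coordinates

variable {E : Type*} [NormedAddCommGroup E] [NormedSpace ℝ E]

/-- The right-hand side of the Koszul formula for constant fields, as a trilinear form:
`(u, v, w) ↦ ½ (D_u G(v, w) + D_v G(u, w) - D_w G(u, v))`. -/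
def koszulForm (G : E → E →L[ℝ] E →L[ℝ] ℝ) (y : E) : E →L[ℝ] E →L[ℝ] E →L[ℝ] ℝ :=
  let D : E →L[ℝ] E →L[ℝ] E →L[ℝ] ℝ := fderiv ℝ G y
  let T : E →L[ℝ] E →L[ℝ] E →L[ℝ] ℝ :=
    (ContinuousLinearMap.flipₗᵢ ℝ E E ℝ : (E →L[ℝ] E →L[ℝ] ℝ) →L[ℝ] E →L[ℝ] E →L[ℝ] ℝ) ∘L D.flip
  (1 / 2 : ℝ) • (D + D.flip - T)

theorem koszulForm_apply (G : E → E →L[ℝ] E →L[ℝ] ℝ) (y u v w : E) :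
    koszulForm G y u v w =
      1 / 2 * (fderiv ℝ G y u v w + fderiv ℝ G y v u w - fderiv ℝ G y w u v) := by
  simp [koszulForm]

/-- The Levi-Civita connection of `G`: the vector `Γ(y)(u, v)` represents the Koszul form, i.e.
`G(y)(Γ(y)(u, v), w) = koszulForm G y u v w` for all `w`. Here `(G y).inverse` is the inverse of
the map `u ↦ G(y)(u, ·)` from `E` to its dual, which is invertible where `G` is nondegenerate. -/
def leviCivitaSymbol (G : E → E →L[ℝ] E →L[ℝ] ℝ) (y : E) : E →L[ℝ] E →L[ℝ] E :=
  (ContinuousLinearMap.compL ℝ E (E →L[ℝ] ℝ) E (G y).inverse) ∘L koszulForm G y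

theorem leviCivitaSymbol_apply (G : E → E →L[ℝ] E →L[ℝ] ℝ) (y u v : E) :
    leviCivitaSymbol G y u v = (G y).inverse (koszulForm G y u v) := rfl

/-- The quarter-symmetric connection `∇̄_X Y = ∇_X Y + lam₁ π(Y) X - lam₂ g(X, Y) P` in
coordinates, where `∇` is the Levi-Civita connection of `G` and `π(Y) = G(Y, P)`. -/
def quarterSymmetricSymbol (G : E → E →L[ℝ] E →L[ℝ] ℝ) (P : E → E) (lam₁ lam₂ : ℝ) (y : E) :
    E →L[ℝ] E →L[ℝ] E :=
  leviCivitaSymbol G y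
    + lam₁ • ContinuousLinearMap.smulRightL ℝ E E ((G y).flip (P y))
    - lam₂ • ((ContinuousLinearMap.smulRightL ℝ E E).flip (P y)).comp (G y)

theorem quarterSymmetricSymbol_apply (G : E → E →L[ℝ] E →L[ℝ] ℝ) (P : E → E) (lam₁ lam₂ : ℝ)
    (y u v : E) :
    quarterSymmetricSymbol G P lam₁ lam₂ y u v =
      leviCivitaSymbol G y u v + lam₁ • G y v (P y) • u - lam₂ • G y u v • P y := by
  simp [quarterSymmetricSymbol]

/-- The curvature `R(u, v)w = ∇_u ∇_v w - ∇_v ∇_u w - ∇_[u,v] w` of the connection with Christoffel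
map `Γ`; it is a tensor, and is evaluated here on constant fields, for which `[u, v] = 0`. -/
def curvatureTensor (Γ : E → E →L[ℝ] E →L[ℝ] E) (y u v w : E) : E :=
  fderiv ℝ Γ y u v w - fderiv ℝ Γ y v u w + Γ y u (Γ y v w) - Γ y v (Γ y u w)

/-- The endomorphism `z ↦ R(u, z)v`. -/
def curvatureEnd (Γ : E → E →L[ℝ] E →L[ℝ] E) (y u v : E) : E →ₗ[ℝ] E where
  toFun z := curvatureTensor Γ y u z v
  map_add' z z' := by simp only [curvatureTensor, map_add, add_apply]; abel
  map_smul' c z := by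
    simp only [curvatureTensor, map_smul, smul_apply, RingHom.id_apply,
      smul_add, smul_sub]

/-- The Ricci tensor `Ric(u, v) = tr (z ↦ R(u, z)v) = ∑ₖ εₖ ⟨R(u, Eₖ)v, Eₖ⟩` as a bilinear form. -/
def ricciForm (Γ : E → E →L[ℝ] E →L[ℝ] E) (y : E) : E →ₗ[ℝ] E →ₗ[ℝ] ℝ :=
  LinearMap.mk₂ ℝ (fun u v => LinearMap.trace ℝ E (curvatureEnd Γ y u v))
    (fun u u' v => by
      rw [← map_add]; congr 1; ext z
      simp only [curvatureEnd, curvatureTensor, map_add, add_apply,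
        LinearMap.coe_mk, AddHom.coe_mk, LinearMap.add_apply]; abel)
    (fun c u v => by
      rw [← map_smul]; congr 1; ext z
      simp only [curvatureEnd, curvatureTensor, map_smul, smul_apply,
        LinearMap.coe_mk, AddHom.coe_mk, LinearMap.smul_apply, smul_add, smul_sub])
    (fun u v v' => by
      rw [← map_add]; congr 1; ext z
      simp only [curvatureEnd, curvatureTensor, map_add, LinearMap.coe_mk, AddHom.coe_mk,
        LinearMap.add_apply]; abel)
    (fun c u v => by
      rw [← map_smul]; congr 1; ext z
      simp only [curvatureEnd, curvatureTensor, map_smul,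
        LinearMap.coe_mk, AddHom.coe_mk, LinearMap.smul_apply, smul_add, smul_sub])

theorem ricciForm_apply (Γ : E → E →L[ℝ] E →L[ℝ] E) (y u v : E) :
    ricciForm Γ y u v = LinearMap.trace ℝ E (curvatureEnd Γ y u v) := rfl

/-- The scalar curvature of the connection `Γ` with respect to the metric `G`: the `G`-trace of
the Ricci tensor, i.e. the trace of `u ↦ ♯ Ric(u, ·)`. -/
def scalarCurvatureAt [FiniteDimensional ℝ E] (G : E → E →L[ℝ] E →L[ℝ] ℝ)
    (Γ : E → E →L[ℝ] E →L[ℝ] E) (y : E) : ℝ :=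
  LinearMap.trace ℝ E
    ((G y).inverse.toLinearMap ∘ₗ LinearMap.toContinuousLinearMap.toLinearMap ∘ₗ ricciForm Γ y)

/-- In a basis which is orthonormal for `G y`, the trace is `∑ₖ εₖ ⟨A Eₖ, Eₖ⟩`. -/
theorem trace_eq_sum_orthonormal [FiniteDimensional ℝ E] {ι : Type*} [Fintype ι] [DecidableEq ι]
    (B : E →L[ℝ] E →L[ℝ] ℝ) (e : Module.Basis ι ℝ E) (ε : ι → ℝ)
    (hε : ∀ i, ε i = 1 ∨ ε i = -1) (he : ∀ i j, B (e i) (e j) = if i = j then ε i else 0)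
    (A : E →ₗ[ℝ] E) : LinearMap.trace ℝ E A = ∑ k, ε k * B (A (e k)) (e k) := by
  rw [LinearMap.trace_eq_matrix_trace ℝ e, Matrix.trace]
  refine Finset.sum_congr rfl fun k _ => ?_
  rw [Matrix.diag_apply, LinearMap.toMatrix_apply]
  conv_rhs => rw [← e.sum_repr (A (e k))]
  simp only [map_sum, map_smul, sum_apply, smul_apply, he]
  rcases hε k with h | h <;> simp [h]

/-- The Ricci tensor is `Ric(u, v) = ∑ₖ εₖ ⟨R(u, Eₖ)v, Eₖ⟩` for every orthonormal basis. -/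
theorem ricciForm_eq_sum [FiniteDimensional ℝ E] {ι : Type*} [Fintype ι] [DecidableEq ι]
    (B : E →L[ℝ] E →L[ℝ] ℝ) (Γ : E → E →L[ℝ] E →L[ℝ] E) (y u v : E)
    (e : Module.Basis ι ℝ E) (ε : ι → ℝ) (hε : ∀ i, ε i = 1 ∨ ε i = -1)
    (he : ∀ i j, B (e i) (e j) = if i = j then ε i else 0) :
    ricciForm Γ y u v = ∑ k, ε k * B (curvatureTensor Γ y u (e k) v) (e k) :=
  trace_eq_sum_orthonormal B e ε hε he _

/-- The scalar curvature is `S = ∑ₖ εₖ Ric(Eₖ, Eₖ)` for every orthonormal basis. -/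
theorem scalarCurvatureAt_eq_sum [FiniteDimensional ℝ E] {ι : Type*} [Fintype ι] [DecidableEq ι]
    (G : E → E →L[ℝ] E →L[ℝ] ℝ) (Γ : E → E →L[ℝ] E →L[ℝ] E) (y : E)
    (e : Module.Basis ι ℝ E) (ε : ι → ℝ) (hε : ∀ i, ε i = 1 ∨ ε i = -1)
    (he : ∀ i j, G y (e i) (e j) = if i = j then ε i else 0) :
    scalarCurvatureAt G Γ y = ∑ k, ε k * ricciForm Γ y (e k) (e k) := by
  have hinj : Function.Injective (G y) := by
    rw [injective_iff_map_eq_zero]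
    intro x hx
    apply e.repr.injective
    ext k
    have h : G y x (e k) = 0 := by rw [hx]; rfl
    rw [← e.sum_repr x] at h
    simp only [map_sum, map_smul, sum_apply, smul_apply,
      he] at h
    rcases hε k with h' | h' <;> simpa [h'] using h
  have hdim : Module.finrank ℝ E = Module.finrank ℝ (E →L[ℝ] ℝ) := by
    rw [← (LinearMap.toContinuousLinearMap (𝕜 := ℝ) (E := E) (F' := ℝ)).finrank_eq]
    exact (Subspace.dual_finrank_eq (K := ℝ) (V := E)).symm
  let L : E ≃L[ℝ] (E →L[ℝ] ℝ) :=
    (LinearEquiv.ofInjectiveOfFinrankEq (G y).toLinearMap hinj hdim).toContinuousLinearEquiv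
  have hL : G y = (L : E →L[ℝ] (E →L[ℝ] ℝ)) := by ext a; rfl
  rw [scalarCurvatureAt, trace_eq_sum_orthonormal (G y) e ε hε he]
  refine Finset.sum_congr rfl fun k _ => ?_
  congr 1
  have hinv : ∀ α : E →L[ℝ] ℝ, G y ((G y).inverse α) = α := by
    intro α
    rw [hL, ContinuousLinearMap.inverse_equiv]
    exact L.apply_symm_apply α
  simp only [LinearMap.comp_apply]
  exact congrArg (fun α : E →L[ℝ] ℝ => α (e k)) (hinv _)

end Coordinates

/-! ### Pseudo-Riemannian manifolds with a quarter-symmetric connection -/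

section Manifolds

variable {E : Type*} [NormedAddCommGroup E] [NormedSpace ℝ E]
  {H : Type*} [TopologicalSpace H] (I : ModelWithCorners ℝ E H)
  {M : Type*} [TopologicalSpace M] [ChartedSpace H M]

/-- The pull-back of a field of bilinear forms: `(f^* B)_x(u, v) = B_{f x}(df_x u, df_x v)`. -/
def pullbackForm {E' : Type*} [NormedAddCommGroup E'] [NormedSpace ℝ E'] {H' : Type*}
    [TopologicalSpace H'] (I' : ModelWithCorners ℝ E' H') {N : Type*} [TopologicalSpace N]
    [ChartedSpace H' N] (f : M → N)
    (B : ∀ y : N, TangentSpace I' y →L[ℝ] TangentSpace I' y →L[ℝ] ℝ) (x : M) :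
    TangentSpace I x →L[ℝ] TangentSpace I x →L[ℝ] ℝ :=
  (ContinuousLinearMap.precomp ℝ (mfderiv I I' f x)) ∘L B (f x) ∘L mfderiv I I' f x

/-- The coordinate expression of the metric `g` in the preferred chart at `x₀`: the pull-back of
`g` under the inverse of the chart. -/
def metricInChart (g : ∀ x : M, TangentSpace I x →L[ℝ] TangentSpace I x →L[ℝ] ℝ) (x₀ : M) :
    E → E →L[ℝ] E →L[ℝ] ℝ :=
  pullbackForm 𝓘(ℝ, E) I (extChartAt I x₀).symm g

/-- The coordinate expression of the vector field `P` in the preferred chart at `x₀`. -/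
def fieldInChart (P : ∀ x : M, TangentSpace I x) (x₀ : M) : E → E :=
  VectorField.mpullback 𝓘(ℝ, E) I (extChartAt I x₀).symm P

/-- The scalar curvature at `x` of the connection `∇̄_X Y = ∇_X Y + lam₁ π(Y) X - lam₂ g(X, Y) P`
on the manifold (without boundary) `M` with the pseudo-Riemannian metric `g`, where `∇` is the
Levi-Civita connection of `g` and `π(Y) = g(Y, P)`. It is computed in the preferred chart at `x`;
curvature being a tensor, it does not depend on the chart. -/
def quarterSymmetricScalarCurvature [FiniteDimensional ℝ E]
    (g : ∀ x : M, TangentSpace I x →L[ℝ] TangentSpace I x →L[ℝ] ℝ)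
    (P : ∀ x : M, TangentSpace I x) (lam₁ lam₂ : ℝ) (x : M) : ℝ :=
  scalarCurvatureAt (metricInChart I g x)
    (quarterSymmetricSymbol (metricInChart I g x) (fieldInChart I P x) lam₁ lam₂)
    (extChartAt I x x)

end Manifolds

/-! ### Multiply warped products of an interval with three one-dimensional fibres -/

section Kasner

variable (J : TopologicalSpace.Opens ℝ) {F₁ F₂ F₃ : Type*}
  [TopologicalSpace F₁] [ChartedSpace ℝ F₁] [TopologicalSpace F₂] [ChartedSpace ℝ F₂]
  [TopologicalSpace F₃] [ChartedSpace ℝ F₃]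

/-- The model of a product of four one-dimensional manifolds without boundary. -/
abbrev prodModel : ModelWithCorners ℝ (ℝ × ℝ × ℝ × ℝ) (ModelProd ℝ (ModelProd ℝ (ModelProd ℝ ℝ))) :=
  𝓘(ℝ, ℝ).prod (𝓘(ℝ, ℝ).prod (𝓘(ℝ, ℝ).prod 𝓘(ℝ, ℝ)))

/-- A smooth Riemannian metric on a one-dimensional manifold. -/
abbrev FibreMetric (F : Type*) [TopologicalSpace F] [ChartedSpace ℝ F]
    [IsManifold 𝓘(ℝ, ℝ) ∞ F] :=
  Bundle.ContMDiffRiemannianMetric 𝓘(ℝ, ℝ) ∞ ℝ (fun x : F => TangentSpace 𝓘(ℝ, ℝ) x)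

variable [IsManifold 𝓘(ℝ, ℝ) ∞ F₁] [IsManifold 𝓘(ℝ, ℝ) ∞ F₂] [IsManifold 𝓘(ℝ, ℝ) ∞ F₃]

/-- The metric `-dt² ⊕ b₁² g₁ ⊕ b₂² g₂ ⊕ b₃² g₃` on `J × F₁ × F₂ × F₃`, each summand being
pulled back under the projection. -/
def multiplyWarpedMetric (b₁ b₂ b₃ : ℝ → ℝ)
    (g₁ : FibreMetric F₁) (g₂ : FibreMetric F₂) (g₃ : FibreMetric F₃) (x : J × F₁ × F₂ × F₃) :
    TangentSpace prodModel x →L[ℝ] TangentSpace prodModel x →L[ℝ] ℝ :=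
  - pullbackForm prodModel 𝓘(ℝ, ℝ) (fun z : J × F₁ × F₂ × F₃ => (z.1 : ℝ))
      (fun _ => ContinuousLinearMap.mul ℝ ℝ) x
    + b₁ x.1 ^ 2 • pullbackForm prodModel 𝓘(ℝ, ℝ) (fun z : J × F₁ × F₂ × F₃ => z.2.1) g₁.inner x
    + b₂ x.1 ^ 2 • pullbackForm prodModel 𝓘(ℝ, ℝ) (fun z : J × F₁ × F₂ × F₃ => z.2.2.1) g₂.inner x
    + b₃ x.1 ^ 2 • pullbackForm prodModel 𝓘(ℝ, ℝ) (fun z : J × F₁ × F₂ × F₃ => z.2.2.2) g₃.inner x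

/-- The metric of the type (III) generalized Kasner space-time
`J ×_{φ^p₁} F₁ ×_{φ^p₂} F₂ ×_{φ^p₃} F₃`. -/
def kasnerMetric (φ : ℝ → ℝ) (p₁ p₂ p₃ : ℝ)
    (g₁ : FibreMetric F₁) (g₂ : FibreMetric F₂) (g₃ : FibreMetric F₃) (x : J × F₁ × F₂ × F₃) :
    TangentSpace prodModel x →L[ℝ] TangentSpace prodModel x →L[ℝ] ℝ :=
  multiplyWarpedMetric J (fun t => φ t ^ p₁) (fun t => φ t ^ p₂) (fun t => φ t ^ p₃) g₁ g₂ g₃ x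

/-- The vector field `∂/∂t` on `J × F₁ × F₂ × F₃`: the velocity of `t ↦ (t, x₁, x₂, x₃)`. The
chart of the open set `J ⊆ ℝ` is the inclusion, so that the unit vector of `T_t J = ℝ` is `1`. -/
def dtField (x : J × F₁ × F₂ × F₃) : TangentSpace prodModel x :=
  mfderiv 𝓘(ℝ, ℝ) prodModel (fun t : J => ((t, x.2) : J × F₁ × F₂ × F₃)) x.1 (1 : ℝ)

end Kasner

end

/-! Write `H = φ'/φ`. In product charts the metric is diagonal, with entries `-1` and `(φ ^ pᵢ)²
aᵢ`, where `aᵢ` depends on the `i`-th fibre coordinate alone. The half logarithmic derivatives of an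
entry are `pᵢ H` in `t` and some `αᵢ` along its own fibre. Fibres of dimension one contribute no
curvature, so every `αᵢ` cancels and the scalar curvature is a function of `t`: `-2ζ H' - (η + ζ²)
H² + 3(lam₁ + lam₂) ζ H + K` (`scalarCurvatureAt_warped` in coordinates,
`quarterSymmetricScalarCurvature_kasner` on the manifold). The theorem thus reduces to solving the
equation "this expression equals `S`" on an interval.

If `ζ = 0`, what remains is `η H² = K - S`. For `η = 0` this says `S = K`. For `η > 0`, `H²` is
constant, and by continuity and connectedness so is `H`; hence `φ` is an exponential
(`constant_scalar_iff_of_sum_zero`).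

If `ζ ≠ 0`, it is a Riccati equation for `H`. With `q = (η + ζ²) / (2ζ)` the substitution `ψ = φ ^
q` linearises it to `ψ'' = (3/2)(lam₁ + lam₂) ψ' - C ψ`, where `C = (S - K)(η + ζ²) / (4ζ²)`
(`linear_of_riccati`, with converse `riccati_of_linear`). The characteristic polynomial has
discriminant `D`, a positive multiple of `T - S`, so comparing `S` with `T` separates real distinct,
double and complex roots (`constant_scalar_iff_of_sum_ne_zero`). -/

noncomputable section

/-! ### Scalar curvature of a diagonal metric in coordinates -/

section Model

local notation "V" => ℝ × ℝ × ℝ × ℝ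

/-- The first coordinate of `ℝ × ℝ × ℝ × ℝ`. -/
abbrev coordT : V →L[ℝ] ℝ := ContinuousLinearMap.fst ℝ ℝ (ℝ × ℝ × ℝ)
/-- The second coordinate of `ℝ × ℝ × ℝ × ℝ`. -/
abbrev coordX : V →L[ℝ] ℝ :=
  ContinuousLinearMap.fst ℝ ℝ (ℝ × ℝ) ∘L ContinuousLinearMap.snd ℝ ℝ (ℝ × ℝ × ℝ)
/-- The third coordinate of `ℝ × ℝ × ℝ × ℝ`. -/
abbrev coordY : V →L[ℝ] ℝ :=
  ContinuousLinearMap.fst ℝ ℝ ℝ ∘L ContinuousLinearMap.snd ℝ ℝ (ℝ × ℝ)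
    ∘L ContinuousLinearMap.snd ℝ ℝ (ℝ × ℝ × ℝ)
/-- The fourth coordinate of `ℝ × ℝ × ℝ × ℝ`. -/
abbrev coordZ : V →L[ℝ] ℝ :=
  ContinuousLinearMap.snd ℝ ℝ ℝ ∘L ContinuousLinearMap.snd ℝ ℝ (ℝ × ℝ)
    ∘L ContinuousLinearMap.snd ℝ ℝ (ℝ × ℝ × ℝ)

/-- The form `-dt² + A₁ dx² + A₂ dy² + A₃ dz²`. -/
def diagForm (A₁ A₂ A₃ : ℝ) : V →L[ℝ] V →L[ℝ] ℝ :=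
  -(coordT.smulRight coordT) + A₁ • coordX.smulRight coordX + A₂ • coordY.smulRight coordY
    + A₃ • coordZ.smulRight coordZ

theorem diagForm_apply (A₁ A₂ A₃ : ℝ) (u v : V) :
    diagForm A₁ A₂ A₃ u v = -(u.1 * v.1) + A₁ * (u.2.1 * v.2.1) + A₂ * (u.2.2.1 * v.2.2.1)
      + A₃ * (u.2.2.2 * v.2.2.2) := by
  simp [diagForm]

theorem diagForm_inverse_apply {A₁ A₂ A₃ : ℝ} (h₁ : A₁ ≠ 0) (h₂ : A₂ ≠ 0) (h₃ : A₃ ≠ 0)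
    (α : V →L[ℝ] ℝ) :
    (diagForm A₁ A₂ A₃).inverse α =
      (-α (1, 0, 0, 0), α (0, 1, 0, 0) / A₁, α (0, 0, 1, 0) / A₂, α (0, 0, 0, 1) / A₃) := by
  -- `ContinuousLinearMap.inverse` is the true inverse only for an equivalence, so one is built with
  -- the claimed inverse.
  let L : V ≃L[ℝ] (V →L[ℝ] ℝ) := LinearEquiv.toContinuousLinearEquiv
    { toFun := diagForm A₁ A₂ A₃
      map_add' := map_add _
      map_smul' := map_smul _
      invFun := fun α =>
        (-α (1, 0, 0, 0), α (0, 1, 0, 0) / A₁, α (0, 0, 1, 0) / A₂, α (0, 0, 0, 1) / A₃)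
      left_inv := fun u => by
        simp [diagForm_apply, h₁, h₂, h₃]
      right_inv := fun α => by
        ext <;> simp [diagForm_apply, h₁, h₂, h₃, mul_div_cancel₀] <;> rfl }
  have hL : diagForm A₁ A₂ A₃ = (L : V →L[ℝ] (V →L[ℝ] ℝ)) := by ext <;> rfl
  rw [hL, ContinuousLinearMap.inverse_equiv]
  rfl

theorem trace_prod_four (A : V →ₗ[ℝ] V) :
    LinearMap.trace ℝ V A = (A (1, 0, 0, 0)).1 + (A (0, 1, 0, 0)).2.1 + (A (0, 0, 1, 0)).2.2.1
      + (A (0, 0, 0, 1)).2.2.2 := by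
  let f : V ≃ₗ[ℝ] (Fin 4 → ℝ) :=
    { toFun := fun u => ![u.1, u.2.1, u.2.2.1, u.2.2.2]
      map_add' := fun u v => by ext i; fin_cases i <;> rfl
      map_smul' := fun c v => by ext i; fin_cases i <;> rfl
      invFun := fun w => (w 0, w 1, w 2, w 3)
      left_inv := fun u => rfl
      right_inv := fun w => by ext i; fin_cases i <;> rfl }
  rw [← LinearMap.trace_conj' A f, LinearMap.trace_eq_matrix_trace ℝ (Pi.basisFun ℝ (Fin 4)),
    Matrix.trace, Fin.sum_univ_four]
  have hs (w) : f.symm w = (w 0, w 1, w 2, w 3) := rfl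
  have hf (u) : f u = ![u.1, u.2.1, u.2.2.1, u.2.2.2] := rfl
  clear_value f
  simp [LinearEquiv.conj_apply, hs, hf]

/-- The coordinate basis is orthogonal but not normalised; raising an index supplies the weights
`-1` and `1 / Aᵢ`. -/
theorem scalarCurvatureAt_diagForm {G : V → V →L[ℝ] V →L[ℝ] ℝ} (Γ : V → V →L[ℝ] V →L[ℝ] V)
    {y : V} {A₁ A₂ A₃ : ℝ} (h₁ : A₁ ≠ 0) (h₂ : A₂ ≠ 0) (h₃ : A₃ ≠ 0)
    (hG : G y = diagForm A₁ A₂ A₃) :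
    scalarCurvatureAt G Γ y =
      -ricciForm Γ y (1, 0, 0, 0) (1, 0, 0, 0)
        + ricciForm Γ y (0, 1, 0, 0) (0, 1, 0, 0) / A₁
        + ricciForm Γ y (0, 0, 1, 0) (0, 0, 1, 0) / A₂
        + ricciForm Γ y (0, 0, 0, 1) (0, 0, 0, 1) / A₃ := by
  rw [scalarCurvatureAt, trace_prod_four, hG]
  simp [diagForm_inverse_apply h₁ h₂ h₃]

/-- The connection with `Γ⁰₀₀ = k`, `Γ⁰ᵢᵢ = qᵢ`, `Γⁱ₀ᵢ = hᵢ`, `Γⁱᵢ₀ = hᵢ - l`, `Γⁱᵢᵢ = αᵢ`. -/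
def diagSymbol (k l : ℝ) (q₁ q₂ q₃ h₁ h₂ h₃ α₁ α₂ α₃ : ℝ) : V →L[ℝ] V →L[ℝ] V :=
  k • coordT.smulRight (coordT.smulRight ((1, 0, 0, 0) : V))
  + q₁ • coordX.smulRight (coordX.smulRight ((1, 0, 0, 0) : V))
  + q₂ • coordY.smulRight (coordY.smulRight ((1, 0, 0, 0) : V))
  + q₃ • coordZ.smulRight (coordZ.smulRight ((1, 0, 0, 0) : V))
  + h₁ • coordT.smulRight (coordX.smulRight ((0, 1, 0, 0) : V))
  + (h₁ - l) • coordX.smulRight (coordT.smulRight ((0, 1, 0, 0) : V))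
  + α₁ • coordX.smulRight (coordX.smulRight ((0, 1, 0, 0) : V))
  + h₂ • coordT.smulRight (coordY.smulRight ((0, 0, 1, 0) : V))
  + (h₂ - l) • coordY.smulRight (coordT.smulRight ((0, 0, 1, 0) : V))
  + α₂ • coordY.smulRight (coordY.smulRight ((0, 0, 1, 0) : V))
  + h₃ • coordT.smulRight (coordZ.smulRight ((0, 0, 0, 1) : V))
  + (h₃ - l) • coordZ.smulRight (coordT.smulRight ((0, 0, 0, 1) : V))
  + α₃ • coordZ.smulRight (coordZ.smulRight ((0, 0, 0, 1) : V))

theorem diagSymbol_apply (k l q₁ q₂ q₃ h₁ h₂ h₃ α₁ α₂ α₃ : ℝ) (u v : V) :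
    diagSymbol k l q₁ q₂ q₃ h₁ h₂ h₃ α₁ α₂ α₃ u v =
      (k * (u.1 * v.1) + q₁ * (u.2.1 * v.2.1) + q₂ * (u.2.2.1 * v.2.2.1)
          + q₃ * (u.2.2.2 * v.2.2.2),
        h₁ * (u.1 * v.2.1) + (h₁ - l) * (u.2.1 * v.1) + α₁ * (u.2.1 * v.2.1),
        h₂ * (u.1 * v.2.2.1) + (h₂ - l) * (u.2.2.1 * v.1) + α₂ * (u.2.2.1 * v.2.2.1),
        h₃ * (u.1 * v.2.2.2) + (h₃ - l) * (u.2.2.2 * v.1) + α₃ * (u.2.2.2 * v.2.2.2)) := by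
  ext <;> simp [diagSymbol]

theorem fderiv_diagForm {A₁ A₂ A₃ : V → ℝ} {A₁' A₂' A₃' : V →L[ℝ] ℝ} {y : V}
    (h₁ : HasFDerivAt A₁ A₁' y) (h₂ : HasFDerivAt A₂ A₂' y) (h₃ : HasFDerivAt A₃ A₃' y)
    (u v w : V) :
    fderiv ℝ (fun y => diagForm (A₁ y) (A₂ y) (A₃ y)) y u v w =
      A₁' u * (v.2.1 * w.2.1) + A₂' u * (v.2.2.1 * w.2.2.1) + A₃' u * (v.2.2.2 * w.2.2.2) := by
  have h : HasFDerivAt (fun y => diagForm (A₁ y) (A₂ y) (A₃ y)) _ y :=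
    (((hasFDerivAt_const (-(coordT.smulRight coordT) : V →L[ℝ] V →L[ℝ] ℝ) y).add
    (h₁.smul_const (coordX.smulRight coordX))).add
    (h₂.smul_const (coordY.smulRight coordY))).add
    (h₃.smul_const (coordZ.smulRight coordZ))
  rw [h.fderiv]
  simp

/-- Since `k` and `l` are constants and the symbol is affine in its coefficients, the derivative is
again a `diagSymbol`, with `k` and `l` replaced by `0`. -/
theorem fderiv_diagSymbol {k l : ℝ} {q₁ q₂ q₃ h₁ h₂ h₃ α₁ α₂ α₃ : V → ℝ}
    {q₁' q₂' q₃' h₁' h₂' h₃' α₁' α₂' α₃' : V →L[ℝ] ℝ} {y : V}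
    (hq₁ : HasFDerivAt q₁ q₁' y) (hq₂ : HasFDerivAt q₂ q₂' y) (hq₃ : HasFDerivAt q₃ q₃' y)
    (hh₁ : HasFDerivAt h₁ h₁' y) (hh₂ : HasFDerivAt h₂ h₂' y) (hh₃ : HasFDerivAt h₃ h₃' y)
    (hα₁ : HasFDerivAt α₁ α₁' y) (hα₂ : HasFDerivAt α₂ α₂' y) (hα₃ : HasFDerivAt α₃ α₃' y)
    (u : V) :
    fderiv ℝ (fun y => diagSymbol k l (q₁ y) (q₂ y) (q₃ y) (h₁ y) (h₂ y) (h₃ y)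
        (α₁ y) (α₂ y) (α₃ y)) y u =
      diagSymbol 0 0 (q₁' u) (q₂' u) (q₃' u) (h₁' u) (h₂' u) (h₃' u)
        (α₁' u) (α₂' u) (α₃' u) := by
  have h : HasFDerivAt (fun y => diagSymbol k l (q₁ y) (q₂ y) (q₃ y) (h₁ y) (h₂ y) (h₃ y)
      (α₁ y) (α₂ y) (α₃ y)) _ y :=
    (((((((((((hasFDerivAt_const
      (k • coordT.smulRight (coordT.smulRight ((1, 0, 0, 0) : V)) : V →L[ℝ] V →L[ℝ] V) y).add
    (hq₁.smul_const (coordX.smulRight (coordX.smulRight ((1, 0, 0, 0) : V))))).add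
    (hq₂.smul_const (coordY.smulRight (coordY.smulRight ((1, 0, 0, 0) : V))))).add
    (hq₃.smul_const (coordZ.smulRight (coordZ.smulRight ((1, 0, 0, 0) : V))))).add
    (hh₁.smul_const (coordT.smulRight (coordX.smulRight ((0, 1, 0, 0) : V))))).add
    ((hh₁.sub_const l).smul_const (coordX.smulRight (coordT.smulRight ((0, 1, 0, 0) : V))))).add
    (hα₁.smul_const (coordX.smulRight (coordX.smulRight ((0, 1, 0, 0) : V))))).add
    (hh₂.smul_const (coordT.smulRight (coordY.smulRight ((0, 0, 1, 0) : V))))).add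
    ((hh₂.sub_const l).smul_const (coordY.smulRight (coordT.smulRight ((0, 0, 1, 0) : V))))).add
    (hα₂.smul_const (coordY.smulRight (coordY.smulRight ((0, 0, 1, 0) : V))))).add
    (hh₃.smul_const (coordT.smulRight (coordZ.smulRight ((0, 0, 0, 1) : V))))).add
    ((hh₃.sub_const l).smul_const (coordZ.smulRight (coordT.smulRight ((0, 0, 0, 1) : V)))) |>.add
    (hα₃.smul_const (coordZ.smulRight (coordZ.smulRight ((0, 0, 0, 1) : V))))
  rw [h.fderiv]
  simp [diagSymbol]

/-- Levi-Civita contributes `Γⁱ₀ᵢ = Γⁱᵢ₀ = hᵢ`, `Γⁱᵢᵢ = αᵢ` and `Γ⁰ᵢᵢ = hᵢ Aᵢ`. As `π(v) = -v⁰`, the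
`lam₁` term lowers `Γ⁰₀₀` and `Γⁱᵢ₀` by `lam₁`; the `lam₂` term adds `lam₂` to `Γ⁰₀₀` and replaces
`hᵢ Aᵢ` by `(hᵢ - lam₂) Aᵢ`. The field `P` enters undifferentiated, so its value at `y` suffices. -/
theorem quarterSymmetricSymbol_diagForm {G : V → V →L[ℝ] V →L[ℝ] ℝ} {P : V → V}
    {A₁ A₂ A₃ : V → ℝ} (lam₁ lam₂ h₁ h₂ h₃ α₁ α₂ α₃ : ℝ) {y : V}
    (hG : G =ᶠ[nhds y] fun y => diagForm (A₁ y) (A₂ y) (A₃ y)) (hP : P y = (1, 0, 0, 0))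
    (n₁ : A₁ y ≠ 0) (n₂ : A₂ y ≠ 0) (n₃ : A₃ y ≠ 0)
    (hA₁ : HasFDerivAt A₁ ((2 * h₁ * A₁ y) • coordT + (2 * α₁ * A₁ y) • coordX) y)
    (hA₂ : HasFDerivAt A₂ ((2 * h₂ * A₂ y) • coordT + (2 * α₂ * A₂ y) • coordY) y)
    (hA₃ : HasFDerivAt A₃ ((2 * h₃ * A₃ y) • coordT + (2 * α₃ * A₃ y) • coordZ) y) :
    quarterSymmetricSymbol G P lam₁ lam₂ y =
      diagSymbol (lam₂ - lam₁) lam₁ ((h₁ - lam₂) * A₁ y) ((h₂ - lam₂) * A₂ y)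
        ((h₃ - lam₂) * A₃ y) h₁ h₂ h₃ α₁ α₂ α₃ := by
  have key (u v) : quarterSymmetricSymbol G P lam₁ lam₂ y u v =
      diagSymbol (lam₂ - lam₁) lam₁ ((h₁ - lam₂) * A₁ y) ((h₂ - lam₂) * A₂ y)
        ((h₃ - lam₂) * A₃ y) h₁ h₂ h₃ α₁ α₂ α₃ u v := by
    rw [quarterSymmetricSymbol_apply, leviCivitaSymbol_apply, hG.eq_of_nhds,
      diagForm_inverse_apply n₁ n₂ n₃, diagSymbol_apply, hP]
    simp only [koszulForm_apply, hG.fderiv_eq, fderiv_diagForm hA₁ hA₂ hA₃, diagForm_apply]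
    ext <;> simp <;> field_simp <;> ring
  exact ContinuousLinearMap.ext fun u => ContinuousLinearMap.ext fun v => key u v

theorem hasFDerivAt_warp_mul {β a : ℝ → ℝ} (c : V →L[ℝ] ℝ) {y : V} {h α : ℝ}
    (hβ : HasDerivAt β (2 * h * β y.1) y.1) (ha : HasDerivAt a (2 * α * a (c y)) (c y)) :
    HasFDerivAt (fun y : V => β y.1 * a (c y))
      ((2 * h * (β y.1 * a (c y))) • coordT + (2 * α * (β y.1 * a (c y))) • c) y := by
  have h1 : HasFDerivAt (fun y : V => β y.1) _ y :=
    hβ.comp_hasFDerivAt y (coordT.hasFDerivAt)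
  have h2 : HasFDerivAt (fun y : V => a (c y)) _ y := ha.comp_hasFDerivAt y c.hasFDerivAt
  refine (h1.mul h2).congr_fderiv (ContinuousLinearMap.ext fun u => ?_)
  simp only [add_apply, smul_apply, smul_eq_mul]
  ring

/-- The scalar curvature of the quarter-symmetric connection of a multiply warped product metric
with one-dimensional fibres, in coordinates. -/
theorem scalarCurvatureAt_warped {G : V → V →L[ℝ] V →L[ℝ] ℝ} {P : V → V}
    {β₁ β₂ β₃ a₁ a₂ a₃ h₁ h₂ h₃ α₁ α₂ α₃ : ℝ → ℝ} (lam₁ lam₂ : ℝ) {y : V}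
    {h₁' h₂' h₃' α₁' α₂' α₃' : ℝ}
    (hG : G =ᶠ[nhds y] fun y => diagForm (β₁ y.1 * a₁ (coordX y)) (β₂ y.1 * a₂ (coordY y))
      (β₃ y.1 * a₃ (coordZ y)))
    (hP : P =ᶠ[nhds y] fun _ => (1, 0, 0, 0))
    (hβ₁ : ∀ᶠ t in nhds y.1, β₁ t ≠ 0 ∧ HasDerivAt β₁ (2 * h₁ t * β₁ t) t)
    (hβ₂ : ∀ᶠ t in nhds y.1, β₂ t ≠ 0 ∧ HasDerivAt β₂ (2 * h₂ t * β₂ t) t)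
    (hβ₃ : ∀ᶠ t in nhds y.1, β₃ t ≠ 0 ∧ HasDerivAt β₃ (2 * h₃ t * β₃ t) t)
    (ha₁ : ∀ᶠ s in nhds (coordX y), a₁ s ≠ 0 ∧ HasDerivAt a₁ (2 * α₁ s * a₁ s) s)
    (ha₂ : ∀ᶠ s in nhds (coordY y), a₂ s ≠ 0 ∧ HasDerivAt a₂ (2 * α₂ s * a₂ s) s)
    (ha₃ : ∀ᶠ s in nhds (coordZ y), a₃ s ≠ 0 ∧ HasDerivAt a₃ (2 * α₃ s * a₃ s) s)
    (hh₁ : HasDerivAt h₁ h₁' y.1) (hh₂ : HasDerivAt h₂ h₂' y.1) (hh₃ : HasDerivAt h₃ h₃' y.1)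
    (hα₁ : HasDerivAt α₁ α₁' (coordX y)) (hα₂ : HasDerivAt α₂ α₂' (coordY y))
    (hα₃ : HasDerivAt α₃ α₃' (coordZ y)) :
    scalarCurvatureAt G (quarterSymmetricSymbol G P lam₁ lam₂) y =
      -2 * (h₁' + h₁ y.1 ^ 2 + h₂' + h₂ y.1 ^ 2 + h₃' + h₃ y.1 ^ 2)
        - 2 * (h₁ y.1 * h₂ y.1 + h₁ y.1 * h₃ y.1 + h₂ y.1 * h₃ y.1)
        + 3 * (lam₁ + lam₂) * (h₁ y.1 + h₂ y.1 + h₃ y.1)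
        + 3 * (lam₁ ^ 2 + lam₂ ^ 2 - 4 * lam₁ * lam₂) := by
  -- Curvature differentiates the symbol, so it has to be known on a neighbourhood of `y`.
  have hΓ : quarterSymmetricSymbol G P lam₁ lam₂ =ᶠ[nhds y] fun y =>
      diagSymbol (lam₂ - lam₁) lam₁ ((h₁ y.1 - lam₂) * (β₁ y.1 * a₁ (coordX y)))
        ((h₂ y.1 - lam₂) * (β₂ y.1 * a₂ (coordY y))) ((h₃ y.1 - lam₂) * (β₃ y.1 * a₃ (coordZ y)))
        (h₁ y.1) (h₂ y.1) (h₃ y.1) (α₁ (coordX y)) (α₂ (coordY y)) (α₃ (coordZ y)) := by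
    have ct : Filter.Tendsto (fun y : V => y.1) (nhds y) (nhds y.1) := coordT.continuous.continuousAt
    filter_upwards [hG.eventuallyEq_nhds, hP, ct.eventually hβ₁, ct.eventually hβ₂,
      ct.eventually hβ₃, (coordX.continuous.continuousAt (x := y)).eventually ha₁,
      (coordY.continuous.continuousAt (x := y)).eventually ha₂,
      (coordZ.continuous.continuousAt (x := y)).eventually ha₃]
      with z hGz hPz b₁ b₂ b₃ e₁ e₂ e₃
    exact quarterSymmetricSymbol_diagForm (A₁ := fun y => β₁ y.1 * a₁ (coordX y))
      (A₂ := fun y => β₂ y.1 * a₂ (coordY y)) (A₃ := fun y => β₃ y.1 * a₃ (coordZ y))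
      lam₁ lam₂ (h₁ z.1) (h₂ z.1) (h₃ z.1) (α₁ (coordX z)) (α₂ (coordY z)) (α₃ (coordZ z)) hGz hPz
      (mul_ne_zero b₁.1 e₁.1) (mul_ne_zero b₂.1 e₂.1) (mul_ne_zero b₃.1 e₃.1)
      (hasFDerivAt_warp_mul coordX b₁.2 e₁.2) (hasFDerivAt_warp_mul coordY b₂.2 e₂.2)
      (hasFDerivAt_warp_mul coordZ b₃.2 e₃.2)
  obtain ⟨b₁, d₁⟩ := hβ₁.self_of_nhds
  obtain ⟨b₂, d₂⟩ := hβ₂.self_of_nhds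
  obtain ⟨b₃, d₃⟩ := hβ₃.self_of_nhds
  obtain ⟨n₁, e₁⟩ := ha₁.self_of_nhds
  obtain ⟨n₂, e₂⟩ := ha₂.self_of_nhds
  obtain ⟨n₃, e₃⟩ := ha₃.self_of_nhds
  have H₁ : HasFDerivAt (fun y : V => h₁ y.1) _ y := hh₁.comp_hasFDerivAt y coordT.hasFDerivAt
  have H₂ : HasFDerivAt (fun y : V => h₂ y.1) _ y := hh₂.comp_hasFDerivAt y coordT.hasFDerivAt
  have H₃ : HasFDerivAt (fun y : V => h₃ y.1) _ y := hh₃.comp_hasFDerivAt y coordT.hasFDerivAt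
  have hD (u : V) : fderiv ℝ (quarterSymmetricSymbol G P lam₁ lam₂) y u = diagSymbol 0 0
        ((h₁ y.1 - lam₂) * (2 * h₁ y.1 * (β₁ y.1 * a₁ (coordX y)) * u.1
          + 2 * α₁ (coordX y) * (β₁ y.1 * a₁ (coordX y)) * coordX u)
          + β₁ y.1 * a₁ (coordX y) * (h₁' * u.1))
        ((h₂ y.1 - lam₂) * (2 * h₂ y.1 * (β₂ y.1 * a₂ (coordY y)) * u.1
          + 2 * α₂ (coordY y) * (β₂ y.1 * a₂ (coordY y)) * coordY u)
          + β₂ y.1 * a₂ (coordY y) * (h₂' * u.1))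
        ((h₃ y.1 - lam₂) * (2 * h₃ y.1 * (β₃ y.1 * a₃ (coordZ y)) * u.1
          + 2 * α₃ (coordZ y) * (β₃ y.1 * a₃ (coordZ y)) * coordZ u)
          + β₃ y.1 * a₃ (coordZ y) * (h₃' * u.1))
        (h₁' * u.1) (h₂' * u.1) (h₃' * u.1) (α₁' * coordX u) (α₂' * coordY u)
        (α₃' * coordZ u) := by
    rw [hΓ.fderiv_eq]
    refine (fderiv_diagSymbol (k := lam₂ - lam₁) (l := lam₁)
      ((H₁.sub_const lam₂).mul (hasFDerivAt_warp_mul coordX d₁ e₁))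
      ((H₂.sub_const lam₂).mul (hasFDerivAt_warp_mul coordY d₂ e₂))
      ((H₃.sub_const lam₂).mul (hasFDerivAt_warp_mul coordZ d₃ e₃)) H₁ H₂ H₃
      (hα₁.comp_hasFDerivAt y coordX.hasFDerivAt) (hα₂.comp_hasFDerivAt y coordY.hasFDerivAt)
      (hα₃.comp_hasFDerivAt y coordZ.hasFDerivAt) u).trans ?_
    simp only [add_apply, smul_apply, smul_eq_mul]
    rfl
  rw [scalarCurvatureAt_diagForm _ (mul_ne_zero b₁ n₁) (mul_ne_zero b₂ n₂) (mul_ne_zero b₃ n₃)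
    hG.eq_of_nhds]
  -- All ingredients are now explicit; in the resulting rational identity `αᵢ`, `αᵢ'` and the
  -- coefficients `βᵢ aᵢ` cancel.
  simp only [ricciForm_apply, trace_prod_four, curvatureEnd, LinearMap.coe_mk, AddHom.coe_mk,
    curvatureTensor, hD, hΓ.eq_of_nhds, diagSymbol_apply]
  simp
  change a₁ y.2.1 ≠ 0 at n₁
  change a₂ y.2.2.1 ≠ 0 at n₂
  change a₃ y.2.2.2 ≠ 0 at n₃
  field_simp
  ring

end Model

/-! ### The metric and `∂/∂t` in product charts -/

section Charts

section Pullback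

variable {E E' E'' : Type*} [NormedAddCommGroup E] [NormedSpace ℝ E]
  [NormedAddCommGroup E'] [NormedSpace ℝ E'] [NormedAddCommGroup E''] [NormedSpace ℝ E'']
  {H H' H'' : Type*} [TopologicalSpace H] [TopologicalSpace H'] [TopologicalSpace H'']
  {I : ModelWithCorners ℝ E H} {I' : ModelWithCorners ℝ E' H'} {I'' : ModelWithCorners ℝ E'' H''}
  {M N Q : Type*} [TopologicalSpace M] [ChartedSpace H M] [TopologicalSpace N] [ChartedSpace H' N]
  [TopologicalSpace Q] [ChartedSpace H'' Q]

theorem pullbackForm_apply (f : M → N)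
    (B : ∀ y : N, TangentSpace I' y →L[ℝ] TangentSpace I' y →L[ℝ] ℝ) (x : M)
    (u v : TangentSpace I x) :
    pullbackForm I I' f B x u v = B (f x) (mfderiv I I' f x u) (mfderiv I I' f x v) := rfl

theorem pullbackForm_pullbackForm_apply {f : M → N} {h : N → Q}
    (B : ∀ y : Q, TangentSpace I'' y →L[ℝ] TangentSpace I'' y →L[ℝ] ℝ) {x : M}
    (hh : MDifferentiableAt I' I'' h (f x)) (hf : MDifferentiableAt I I' f x)
    (u v : TangentSpace I x) :
    pullbackForm I' I'' h B (f x) (mfderiv I I' f x u) (mfderiv I I' f x v) =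
      pullbackForm I I'' (h ∘ f) B x u v := by
  rw [pullbackForm_apply, pullbackForm_apply, mfderiv_comp x hh hf]
  rfl

theorem mdifferentiableAt_comp_continuousLinearMap (c : E →L[ℝ] E') {σ : E' → N} {y : E}
    (hσ : MDifferentiableAt 𝓘(ℝ, E') I' σ (c y)) :
    MDifferentiableAt 𝓘(ℝ, E) I' (σ ∘ c) y :=
  hσ.comp y c.mdifferentiableAt

theorem mfderiv_comp_continuousLinearMap (c : E →L[ℝ] E') {σ : E' → N} {y : E}
    (hσ : MDifferentiableAt 𝓘(ℝ, E') I' σ (c y)) :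
    mfderiv 𝓘(ℝ, E) I' (σ ∘ c) y = (mfderiv 𝓘(ℝ, E') I' σ (c y)) ∘L c :=
  (hσ.hasMFDerivAt.comp y c.hasMFDerivAt).mfderiv

/-- Meant for `c` a coordinate functional: projecting the inverse product chart to a fibre gives the
inverse chart of that fibre after `c`. -/
theorem pullbackForm_comp_continuousLinearMap_apply (c : E →L[ℝ] E') {σ : E' → N}
    (B : ∀ y : N, TangentSpace I' y →L[ℝ] TangentSpace I' y →L[ℝ] ℝ) {y : E}
    (hσ : MDifferentiableAt 𝓘(ℝ, E') I' σ (c y)) (u v : E) :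
    pullbackForm 𝓘(ℝ, E) I' (σ ∘ c) B y u v =
      pullbackForm 𝓘(ℝ, E') I' σ B (c y) (c u) (c v) :=
  congrArg (fun L : E →L[ℝ] E' => B (σ (c y)) (L u) (L v)) (mfderiv_comp_continuousLinearMap c hσ)

end Pullback

section Boundaryless

variable {E : Type*} [NormedAddCommGroup E] [NormedSpace ℝ E] {H : Type*} [TopologicalSpace H]
  {I : ModelWithCorners ℝ E H} [I.Boundaryless] {M : Type*} [TopologicalSpace M]
  [ChartedSpace H M] [IsManifold I 1 M] {x : M} {y : E}

theorem mdifferentiableAt_extChartAt_symm (hy : y ∈ (extChartAt I x).target) :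
    MDifferentiableAt 𝓘(ℝ, E) I (extChartAt I x).symm y := by
  have := mdifferentiableWithinAt_extChartAt_symm hy
  rwa [I.range_eq_univ, mdifferentiableWithinAt_univ] at this

theorem isInvertible_mfderiv_extChartAt_symm (hy : y ∈ (extChartAt I x).target) :
    (mfderiv 𝓘(ℝ, E) I (extChartAt I x).symm y).IsInvertible := by
  have := isInvertible_mfderivWithin_extChartAt_symm hy
  rwa [I.range_eq_univ, mfderivWithin_univ] at this

end Boundaryless

section Interval

variable (J : TopologicalSpace.Opens ℝ)

theorem mfderiv_opens_val (t : J) :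
    mfderiv 𝓘(ℝ, ℝ) 𝓘(ℝ, ℝ) (fun t : J => (t : ℝ)) t = ContinuousLinearMap.id ℝ ℝ := by
  exact mfderiv_extChartAt_self (I := 𝓘(ℝ, ℝ)) (x := t)

theorem val_extChartAt_symm (t : J) {s : ℝ} (hs : s ∈ (extChartAt 𝓘(ℝ, ℝ) t).target) :
    (((extChartAt 𝓘(ℝ, ℝ) t).symm s : J) : ℝ) = s := by
  have := (extChartAt 𝓘(ℝ, ℝ) t).right_inv hs
  exact this

theorem mdifferentiableAt_opens_val (t : J) :
    MDifferentiableAt 𝓘(ℝ, ℝ) 𝓘(ℝ, ℝ) (fun t : J => (t : ℝ)) t :=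
  (contMDiff_subtype_val (n := 1)).mdifferentiable (by simp) t

/-- The inclusion composed with the inverse chart is the identity near `s`, and the inclusion itself
has derivative the identity; the chain rule leaves no other possibility. -/
theorem mfderiv_extChartAt_opens_symm (t : J) {s : ℝ}
    (hs : s ∈ (extChartAt 𝓘(ℝ, ℝ) t).target) :
    mfderiv 𝓘(ℝ, ℝ) 𝓘(ℝ, ℝ) (extChartAt 𝓘(ℝ, ℝ) t).symm s = ContinuousLinearMap.id ℝ ℝ := by
  have h := mfderiv_comp s (mdifferentiableAt_opens_val J _) (mdifferentiableAt_extChartAt_symm hs)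
  have he : (fun t : J => (t : ℝ)) ∘ (extChartAt 𝓘(ℝ, ℝ) t).symm =ᶠ[nhds s] id := by
    filter_upwards [(isOpen_extChartAt_target t).mem_nhds hs] with r hr
    exact val_extChartAt_symm J t hr
  rw [he.mfderiv_eq, mfderiv_opens_val, mfderiv_id] at h
  ext
  exact congrArg (fun L : ℝ →L[ℝ] ℝ => L 1) h.symm

end Interval

section Fibre

variable {F : Type*} [TopologicalSpace F] [ChartedSpace ℝ F] [IsManifold 𝓘(ℝ, ℝ) ∞ F]

/-- The coefficient of a metric on a one-dimensional manifold in the preferred chart at `x`. -/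
def fibreCoeff (g : FibreMetric F) (x : F) (s : ℝ) : ℝ :=
  pullbackForm 𝓘(ℝ, ℝ) 𝓘(ℝ, ℝ) (extChartAt 𝓘(ℝ, ℝ) x).symm g.inner s (1 : ℝ) (1 : ℝ)

/-- A bilinear form on a line is determined by its value at `(1, 1)`. -/
theorem pullbackForm_fibre_apply (g : FibreMetric F) (x : F) (s u v : ℝ) :
    pullbackForm 𝓘(ℝ, ℝ) 𝓘(ℝ, ℝ) (extChartAt 𝓘(ℝ, ℝ) x).symm g.inner s u v =
      fibreCoeff g x s * (u * v) := by
  have h (b : ℝ →L[ℝ] ℝ →L[ℝ] ℝ) : b u v = b 1 1 * (u * v) := by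
    have hu : b u = u • b 1 := by rw [← map_smul]; simp
    have hv : b 1 v = v • b 1 1 := by rw [← map_smul]; simp
    rw [hu, smul_apply, hv]
    simp
    ring
  exact h _

/-- The differential of the inverse chart is injective, so it maps `1` to a nonzero tangent vector.
-/
theorem fibreCoeff_pos (g : FibreMetric F) {x : F} {s : ℝ}
    (hs : s ∈ (extChartAt 𝓘(ℝ, ℝ) x).target) : 0 < fibreCoeff g x s := by
  have : IsManifold 𝓘(ℝ, ℝ) 1 F := IsManifold.of_le (n := ∞) (by simp)
  have h := isInvertible_mfderiv_extChartAt_symm hs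
  refine g.pos _ _ fun h0 => ?_
  have := h.injective (h0.trans (map_zero _).symm)
  exact (one_ne_zero (α := ℝ)) this

/-- The coefficient is `g(v, v)` for the velocity `v` of the inverse chart `σ`. The tangent map of
`σ` applied to the constant field `1` shows that `v` is smooth along `σ`, and so is `g ∘ σ`;
evaluating a smooth form on smooth fields is smooth. -/
theorem contDiffOn_fibreCoeff (g : FibreMetric F) (x : F) :
    ContDiffOn ℝ ∞ (fibreCoeff g x) (extChartAt 𝓘(ℝ, ℝ) x).target := by
  have : IsManifold 𝓘(ℝ, ℝ) 1 F := IsManifold.of_le (n := ∞) (by simp)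
  set U := (extChartAt 𝓘(ℝ, ℝ) x).target with hU
  have hUo : IsOpen U := isOpen_extChartAt_target x
  have hσ : ContMDiffOn 𝓘(ℝ, ℝ) 𝓘(ℝ, ℝ) ∞ (extChartAt 𝓘(ℝ, ℝ) x).symm U :=
    contMDiffOn_extChartAt_symm x
  have hT := hσ.contMDiffOn_tangentMapWithin (m := ∞) (by simp) hUo.uniqueMDiffOn
  have hone : ContMDiff 𝓘(ℝ, ℝ) 𝓘(ℝ, ℝ).tangent ∞
      (fun s : ℝ => (⟨s, (1 : ℝ)⟩ : TangentBundle 𝓘(ℝ, ℝ) ℝ)) := by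
    have := contMDiff_vectorSpace_iff_contDiff (𝕜 := ℝ) (E := ℝ) (n := ∞)
      (V := fun _ : ℝ => (1 : ℝ))
    exact this.2 contDiff_const
  have hv : ContMDiffOn 𝓘(ℝ, ℝ) 𝓘(ℝ, ℝ).tangent ∞
      (fun s : ℝ => (⟨(extChartAt 𝓘(ℝ, ℝ) x).symm s,
        mfderiv 𝓘(ℝ, ℝ) 𝓘(ℝ, ℝ) (extChartAt 𝓘(ℝ, ℝ) x).symm s (1 : ℝ)⟩ :
        TangentBundle 𝓘(ℝ, ℝ) F)) U := by
    refine (hT.comp hone.contMDiffOn fun s hs => hs).congr fun s hs => ?_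
    simp only [Function.comp, tangentMapWithin, mfderivWithin_of_isOpen hUo hs]
  have hB : ContMDiffOn 𝓘(ℝ, ℝ) (𝓘(ℝ, ℝ).prod 𝓘(ℝ, ℝ →L[ℝ] ℝ →L[ℝ] ℝ)) ∞
      (fun s : ℝ => Bundle.TotalSpace.mk' (ℝ →L[ℝ] ℝ →L[ℝ] ℝ)
        (E := fun (b : F) ↦ (TangentSpace 𝓘(ℝ, ℝ) b →L[ℝ] TangentSpace 𝓘(ℝ, ℝ) b →L[ℝ] ℝ))
        ((extChartAt 𝓘(ℝ, ℝ) x).symm s) (g.inner ((extChartAt 𝓘(ℝ, ℝ) x).symm s))) U :=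
    g.contMDiff.comp_contMDiffOn hσ
  have key : ContMDiffOn 𝓘(ℝ, ℝ) (𝓘(ℝ, ℝ).prod 𝓘(ℝ, ℝ)) ∞
      (fun s ↦ Bundle.TotalSpace.mk' ℝ (E := Bundle.Trivial F ℝ)
        ((extChartAt 𝓘(ℝ, ℝ) x).symm s) (fibreCoeff g x s)) U :=
    ContMDiffOn.clm_bundle_apply₂ (F₁ := ℝ) (F₂ := ℝ) hB hv hv
  intro s hs
  have := key s hs
  simp only [Bundle.contMDiffWithinAt_totalSpace] at this
  exact this.2.contDiffWithinAt

end Fibre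

section Product

variable (J : TopologicalSpace.Opens ℝ) {F₁ F₂ F₃ : Type*}
  [TopologicalSpace F₁] [ChartedSpace ℝ F₁] [TopologicalSpace F₂] [ChartedSpace ℝ F₂]
  [TopologicalSpace F₃] [ChartedSpace ℝ F₃]

theorem mem_extChartAt_prodModel_target {x : J × F₁ × F₂ × F₃} {y : ℝ × ℝ × ℝ × ℝ} :
    y ∈ (extChartAt prodModel x).target ↔ y.1 ∈ (extChartAt 𝓘(ℝ, ℝ) x.1).target ∧
      y.2.1 ∈ (extChartAt 𝓘(ℝ, ℝ) x.2.1).target ∧ y.2.2.1 ∈ (extChartAt 𝓘(ℝ, ℝ) x.2.2.1).target ∧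
      y.2.2.2 ∈ (extChartAt 𝓘(ℝ, ℝ) x.2.2.2).target := by
  simp only [extChartAt_prod, PartialEquiv.prod_target, Set.mem_prod]

theorem extChartAt_prodModel_symm (x : J × F₁ × F₂ × F₃) :
    ((extChartAt prodModel x).symm : ℝ × ℝ × ℝ × ℝ → J × F₁ × F₂ × F₃) =
      fun y => ((extChartAt 𝓘(ℝ, ℝ) x.1).symm y.1,
        (extChartAt (𝓘(ℝ, ℝ).prod (𝓘(ℝ, ℝ).prod 𝓘(ℝ, ℝ))) x.2).symm y.2) := by
  simp only [extChartAt_prod, PartialEquiv.prod_symm]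
  rfl

theorem dtField_apply (x : J × F₁ × F₂ × F₃) : dtField J x = ((1 : ℝ), 0) := by
  rw [dtField]
  have := mfderiv_prod_left (I := 𝓘(ℝ, ℝ)) (I' := 𝓘(ℝ, ℝ).prod (𝓘(ℝ, ℝ).prod 𝓘(ℝ, ℝ)))
    (x₀ := x.1) (y₀ := x.2)
  exact congrArg (fun L : ℝ →L[ℝ] ℝ × ℝ × ℝ × ℝ => L 1) this

variable [IsManifold 𝓘(ℝ, ℝ) ∞ F₁] [IsManifold 𝓘(ℝ, ℝ) ∞ F₂] [IsManifold 𝓘(ℝ, ℝ) ∞ F₃]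

theorem isManifold_prodModel : IsManifold prodModel 1 (J × F₁ × F₂ × F₃) :=
  IsManifold.of_le (n := ∞) (by simp)

/-- The inverse chart splits as a product map. Its fibre part kills `(1, 0)`, and its interval part
has derivative the identity. -/
theorem mfderiv_extChartAt_prodModel_symm_apply {x : J × F₁ × F₂ × F₃} {y : ℝ × ℝ × ℝ × ℝ}
    (hy : y ∈ (extChartAt prodModel x).target) :
    mfderiv 𝓘(ℝ, ℝ × ℝ × ℝ × ℝ) prodModel (extChartAt prodModel x).symm y
      ((1, 0) : ℝ × ℝ × ℝ × ℝ) = ((1, 0) : ℝ × ℝ × ℝ × ℝ) := by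
  have : IsManifold (𝓘(ℝ, ℝ).prod (𝓘(ℝ, ℝ).prod 𝓘(ℝ, ℝ))) 1 (F₁ × F₂ × F₃) :=
    IsManifold.of_le (n := ∞) (by simp)
  have hy' := hy
  rw [extChartAt_prod, PartialEquiv.prod_target] at hy'
  have h₁ := mfderiv_comp_continuousLinearMap (ContinuousLinearMap.fst ℝ ℝ (ℝ × ℝ × ℝ)) (y := y)
    (mdifferentiableAt_extChartAt_symm hy'.1)
  have h₂ := mfderiv_comp_continuousLinearMap (ContinuousLinearMap.snd ℝ ℝ (ℝ × ℝ × ℝ)) (y := y)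
    (mdifferentiableAt_extChartAt_symm hy'.2)
  have h := mfderiv_prodMk
    (mdifferentiableAt_comp_continuousLinearMap (ContinuousLinearMap.fst ℝ ℝ (ℝ × ℝ × ℝ)) (y := y)
      (mdifferentiableAt_extChartAt_symm hy'.1))
    (mdifferentiableAt_comp_continuousLinearMap (ContinuousLinearMap.snd ℝ ℝ (ℝ × ℝ × ℝ)) (y := y)
      (mdifferentiableAt_extChartAt_symm hy'.2))
  rw [h₁, h₂] at h
  rw [extChartAt_prodModel_symm]
  refine (congrArg (fun L : (ℝ × ℝ × ℝ × ℝ) →L[ℝ] (ℝ × ℝ × ℝ × ℝ) => L (1, 0)) h).trans ?_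
  refine Prod.ext ?_ (mfderiv 𝓘(ℝ, ℝ × ℝ × ℝ) (𝓘(ℝ, ℝ).prod (𝓘(ℝ, ℝ).prod 𝓘(ℝ, ℝ)))
    (extChartAt (𝓘(ℝ, ℝ).prod (𝓘(ℝ, ℝ).prod 𝓘(ℝ, ℝ))) x.2).symm y.2).map_zero
  exact congrArg (fun L : ℝ →L[ℝ] ℝ => L 1) (mfderiv_extChartAt_opens_symm J x.1 hy'.1)

theorem fieldInChart_dtField {x : J × F₁ × F₂ × F₃} {y : ℝ × ℝ × ℝ × ℝ}
    (hy : y ∈ (extChartAt prodModel x).target) :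
    fieldInChart prodModel (dtField J) x y = (1, 0, 0, 0) := by
  have := isManifold_prodModel J (F₁ := F₁) (F₂ := F₂) (F₃ := F₃)
  refine (isInvertible_mfderiv_extChartAt_symm hy).inverse_apply_eq.2 ?_
  rw [dtField_apply]
  exact (mfderiv_extChartAt_prodModel_symm_apply J hy).symm

/-- By the chain rule each summand is pulled back along a projection composed with the inverse
chart, and this composite depends on one coordinate only. -/
theorem metricInChart_multiplyWarpedMetric (b₁ b₂ b₃ : ℝ → ℝ)
    (g₁ : FibreMetric F₁) (g₂ : FibreMetric F₂) (g₃ : FibreMetric F₃)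
    {x : J × F₁ × F₂ × F₃} {y : ℝ × ℝ × ℝ × ℝ} (hy : y ∈ (extChartAt prodModel x).target) :
    metricInChart prodModel (multiplyWarpedMetric J b₁ b₂ b₃ g₁ g₂ g₃) x y =
      diagForm (b₁ y.1 ^ 2 * fibreCoeff g₁ x.2.1 (coordX y))
        (b₂ y.1 ^ 2 * fibreCoeff g₂ x.2.2.1 (coordY y))
        (b₃ y.1 ^ 2 * fibreCoeff g₃ x.2.2.2 (coordZ y)) := by
  have := isManifold_prodModel J (F₁ := F₁) (F₂ := F₂) (F₃ := F₃)
  obtain ⟨h₀, h₁, h₂, h₃⟩ := (mem_extChartAt_prodModel_target J).1 hy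
  set Φ := (extChartAt prodModel x).symm with hΦ
  have hd : MDifferentiableAt 𝓘(ℝ, ℝ × ℝ × ℝ × ℝ) prodModel Φ y :=
    mdifferentiableAt_extChartAt_symm hy
  have hv : ((Φ y).1 : ℝ) = y.1 := val_extChartAt_symm J x.1 h₀
  have d₀ : MDifferentiableAt prodModel 𝓘(ℝ, ℝ) (fun z : J × F₁ × F₂ × F₃ => (z.1 : ℝ)) (Φ y) :=
    (mdifferentiableAt_opens_val J _).comp (Φ y) mdifferentiableAt_fst
  have d₁ : MDifferentiableAt prodModel 𝓘(ℝ, ℝ) (fun z : J × F₁ × F₂ × F₃ => z.2.1) (Φ y) :=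
    mdifferentiableAt_fst.comp (Φ y) mdifferentiableAt_snd
  have d₂ : MDifferentiableAt prodModel 𝓘(ℝ, ℝ) (fun z : J × F₁ × F₂ × F₃ => z.2.2.1) (Φ y) :=
    mdifferentiableAt_fst.comp (Φ y) (mdifferentiableAt_snd.comp (Φ y) mdifferentiableAt_snd)
  have d₃ : MDifferentiableAt prodModel 𝓘(ℝ, ℝ) (fun z : J × F₁ × F₂ × F₃ => z.2.2.2) (Φ y) :=
    mdifferentiableAt_snd.comp (Φ y) (mdifferentiableAt_snd.comp (Φ y) mdifferentiableAt_snd)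
  have key (u v : ℝ × ℝ × ℝ × ℝ) :
      multiplyWarpedMetric J b₁ b₂ b₃ g₁ g₂ g₃ (Φ y)
        (mfderiv 𝓘(ℝ, ℝ × ℝ × ℝ × ℝ) prodModel Φ y u)
        (mfderiv 𝓘(ℝ, ℝ × ℝ × ℝ × ℝ) prodModel Φ y v) =
      diagForm (b₁ y.1 ^ 2 * fibreCoeff g₁ x.2.1 (coordX y))
        (b₂ y.1 ^ 2 * fibreCoeff g₂ x.2.2.1 (coordY y))
        (b₃ y.1 ^ 2 * fibreCoeff g₃ x.2.2.2 (coordZ y)) u v := by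
    have e₀ : pullbackForm prodModel 𝓘(ℝ, ℝ) (fun z : J × F₁ × F₂ × F₃ => (z.1 : ℝ))
        (fun _ => ContinuousLinearMap.mul ℝ ℝ) (Φ y)
        (mfderiv 𝓘(ℝ, ℝ × ℝ × ℝ × ℝ) prodModel Φ y u)
        (mfderiv 𝓘(ℝ, ℝ × ℝ × ℝ × ℝ) prodModel Φ y v) = u.1 * v.1 := by
      -- Agreement on the chart target, a neighbourhood of `y`, is enough for the derivative at `y`.
      have he : (fun z : J × F₁ × F₂ × F₃ => (z.1 : ℝ)) ∘ Φ =ᶠ[nhds y] coordT := by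
        filter_upwards [(isOpen_extChartAt_target x).mem_nhds hy] with r hr
        exact val_extChartAt_symm J x.1 ((mem_extChartAt_prodModel_target J).1 hr).1
      exact (pullbackForm_pullbackForm_apply (fun _ => ContinuousLinearMap.mul ℝ ℝ) d₀ hd u v).trans
        (congrArg (fun L : (ℝ × ℝ × ℝ × ℝ) →L[ℝ] ℝ => L u * L v)
          (he.mfderiv_eq.trans coordT.mfderiv_eq))
    have e₁ : pullbackForm prodModel 𝓘(ℝ, ℝ) (fun z : J × F₁ × F₂ × F₃ => z.2.1) g₁.inner (Φ y)
        (mfderiv 𝓘(ℝ, ℝ × ℝ × ℝ × ℝ) prodModel Φ y u)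
        (mfderiv 𝓘(ℝ, ℝ × ℝ × ℝ × ℝ) prodModel Φ y v) =
        fibreCoeff g₁ x.2.1 (coordX y) * (u.2.1 * v.2.1) :=
      (pullbackForm_pullbackForm_apply _ d₁ hd u v).trans
        ((pullbackForm_comp_continuousLinearMap_apply coordX g₁.inner
          (mdifferentiableAt_extChartAt_symm h₁) u v).trans (pullbackForm_fibre_apply _ _ _ _ _))
    have e₂ : pullbackForm prodModel 𝓘(ℝ, ℝ) (fun z : J × F₁ × F₂ × F₃ => z.2.2.1) g₂.inner (Φ y)
        (mfderiv 𝓘(ℝ, ℝ × ℝ × ℝ × ℝ) prodModel Φ y u)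
        (mfderiv 𝓘(ℝ, ℝ × ℝ × ℝ × ℝ) prodModel Φ y v) =
        fibreCoeff g₂ x.2.2.1 (coordY y) * (u.2.2.1 * v.2.2.1) :=
      (pullbackForm_pullbackForm_apply _ d₂ hd u v).trans
        ((pullbackForm_comp_continuousLinearMap_apply coordY g₂.inner
          (mdifferentiableAt_extChartAt_symm h₂) u v).trans (pullbackForm_fibre_apply _ _ _ _ _))
    have e₃ : pullbackForm prodModel 𝓘(ℝ, ℝ) (fun z : J × F₁ × F₂ × F₃ => z.2.2.2) g₃.inner (Φ y)
        (mfderiv 𝓘(ℝ, ℝ × ℝ × ℝ × ℝ) prodModel Φ y u)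
        (mfderiv 𝓘(ℝ, ℝ × ℝ × ℝ × ℝ) prodModel Φ y v) =
        fibreCoeff g₃ x.2.2.2 (coordZ y) * (u.2.2.2 * v.2.2.2) :=
      (pullbackForm_pullbackForm_apply _ d₃ hd u v).trans
        ((pullbackForm_comp_continuousLinearMap_apply coordZ g₃.inner
          (mdifferentiableAt_extChartAt_symm h₃) u v).trans (pullbackForm_fibre_apply _ _ _ _ _))
    rw [multiplyWarpedMetric, diagForm_apply, hv]
    simp only [add_apply, smul_apply, neg_apply, smul_eq_mul]
    rw [e₀, e₁, e₂, e₃]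
    ring
  exact ContinuousLinearMap.ext fun u => ContinuousLinearMap.ext fun v => key u v

end Product

end Charts

/-! ### Linear equations with constant coefficients, and the Riccati substitution -/

section Equations

variable {J : Set ℝ}

theorem exists_eq_const_of_hasDerivAt_zero (hJo : IsOpen J) (hJ : J.OrdConnected) {f : ℝ → ℝ}
    (hf : ∀ t ∈ J, HasDerivAt f 0 t) : ∃ c, ∀ t ∈ J, f t = c :=
  hJo.exists_is_const_of_deriv_eq_zero hJ.isPreconnected
    (fun t ht => (hf t ht).differentiableAt.differentiableWithinAt) fun t ht => (hf t ht).deriv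

theorem hasDerivAt_exp_mul (r t : ℝ) :
    HasDerivAt (fun t => Real.exp (r * t)) (r * Real.exp (r * t)) t := by
  simpa [mul_comm] using ((hasDerivAt_id t).const_mul r).exp

theorem exists_eq_mul_exp (hJo : IsOpen J) (hJ : J.OrdConnected) {f : ℝ → ℝ} {r : ℝ}
    (hf : ∀ t ∈ J, HasDerivAt f (r * f t) t) : ∃ c, ∀ t ∈ J, f t = c * Real.exp (r * t) := by
  obtain ⟨c, hc⟩ := exists_eq_const_of_hasDerivAt_zero hJo hJ
    (f := fun t => f t * Real.exp (-r * t)) fun t ht =>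
      ((hf t ht).mul (hasDerivAt_exp_mul (-r) t)).congr_deriv (by ring)
  refine ⟨c, fun t ht => ?_⟩
  rw [← hc t ht, mul_assoc, ← Real.exp_add]
  simp

/-- Factoring the operator, `f' - s f` grows at rate `r` and `f' - r f` at rate `s`; their
difference is `(r - s) f`. -/
theorem exists_eq_of_distinct_roots (hJo : IsOpen J) (hJ : J.OrdConnected) {f f' : ℝ → ℝ} {r s : ℝ}
    (hrs : r ≠ s) (hf : ∀ t ∈ J, HasDerivAt f (f' t) t)
    (hf' : ∀ t ∈ J, HasDerivAt f' ((r + s) * f' t - r * s * f t) t) :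
    ∃ c₁ c₂, ∀ t ∈ J, f t = c₁ * Real.exp (r * t) + c₂ * Real.exp (s * t) := by
  obtain ⟨k₁, h₁⟩ := exists_eq_mul_exp hJo hJ (f := fun t => f' t - s * f t) (r := r) fun t ht =>
    ((hf' t ht).sub ((hf t ht).const_mul s)).congr_deriv (by ring)
  obtain ⟨k₂, h₂⟩ := exists_eq_mul_exp hJo hJ (f := fun t => f' t - r * f t) (r := s) fun t ht =>
    ((hf' t ht).sub ((hf t ht).const_mul r)).congr_deriv (by ring)
  have hne : r - s ≠ 0 := sub_ne_zero.2 hrs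
  refine ⟨k₁ / (r - s), -k₂ / (r - s), fun t ht => ?_⟩
  have e₁ := h₁ t ht
  have e₂ := h₂ t ht
  field_simp
  linear_combination e₁ - e₂

/-- Here `f' - r f = k e^{rt}`, so `f - k t e^{rt}` solves the first-order equation of rate `r`. -/
theorem exists_eq_of_double_root (hJo : IsOpen J) (hJ : J.OrdConnected) {f f' : ℝ → ℝ} {r : ℝ}
    (hf : ∀ t ∈ J, HasDerivAt f (f' t) t)
    (hf' : ∀ t ∈ J, HasDerivAt f' (2 * r * f' t - r ^ 2 * f t) t) :
    ∃ c₁ c₂, ∀ t ∈ J, f t = c₁ * Real.exp (r * t) + c₂ * t * Real.exp (r * t) := by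
  obtain ⟨k, hk⟩ := exists_eq_mul_exp hJo hJ (f := fun t => f' t - r * f t) (r := r) fun t ht =>
    ((hf' t ht).sub ((hf t ht).const_mul r)).congr_deriv (by ring)
  obtain ⟨c, hc⟩ := exists_eq_mul_exp hJo hJ (f := fun t => f t - k * t * Real.exp (r * t)) (r := r)
    fun t ht => ((hf t ht).sub (((hasDerivAt_id t).const_mul k).mul
      (hasDerivAt_exp_mul r t))).congr_deriv (by
        have := hk t ht
        simp only [id]
        linear_combination this)
  exact ⟨c, k, fun t ht => by linear_combination hc t ht⟩

theorem hasDerivAt_cos_mul (w t : ℝ) :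
    HasDerivAt (fun t => Real.cos (w * t)) (-w * Real.sin (w * t)) t := by
  simpa [mul_comm] using ((hasDerivAt_id t).const_mul w).cos

theorem hasDerivAt_sin_mul (w t : ℝ) :
    HasDerivAt (fun t => Real.sin (w * t)) (w * Real.cos (w * t)) t := by
  simpa [mul_comm] using ((hasDerivAt_id t).const_mul w).sin

/-- Rotating the pair `(w f, f' - m f)` by the angle `w t` removes the oscillation: both components
then satisfy the first-order equation of rate `m`. Rotating back recovers `w f`. -/
theorem exists_eq_of_complex_roots (hJo : IsOpen J) (hJ : J.OrdConnected) {f f' : ℝ → ℝ} {m w : ℝ}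
    (hw : w ≠ 0) (hf : ∀ t ∈ J, HasDerivAt f (f' t) t)
    (hf' : ∀ t ∈ J, HasDerivAt f' (2 * m * f' t - (m ^ 2 + w ^ 2) * f t) t) :
    ∃ c₁ c₂, ∀ t ∈ J, f t = c₁ * Real.exp (m * t) * Real.cos (w * t)
      + c₂ * Real.exp (m * t) * Real.sin (w * t) := by
  obtain ⟨k₁, h₁⟩ := exists_eq_mul_exp hJo hJ (r := m)
    (f := fun t => w * f t * Real.cos (w * t) - (f' t - m * f t) * Real.sin (w * t)) fun t ht =>
      ((((hf t ht).const_mul w).mul (hasDerivAt_cos_mul w t)).sub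
        (((hf' t ht).sub ((hf t ht).const_mul m)).mul (hasDerivAt_sin_mul w t))).congr_deriv
          (by simp only [Pi.sub_apply]; ring)
  obtain ⟨k₂, h₂⟩ := exists_eq_mul_exp hJo hJ (r := m)
    (f := fun t => w * f t * Real.sin (w * t) + (f' t - m * f t) * Real.cos (w * t)) fun t ht =>
      ((((hf t ht).const_mul w).mul (hasDerivAt_sin_mul w t)).add
        (((hf' t ht).sub ((hf t ht).const_mul m)).mul (hasDerivAt_cos_mul w t))).congr_deriv
          (by simp only [Pi.sub_apply]; ring)
  refine ⟨k₁ / w, k₂ / w, fun t ht => ?_⟩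
  field_simp
  linear_combination Real.cos (w * t) * h₁ t ht + Real.sin (w * t) * h₂ t ht
    - w * f t * Real.sin_sq_add_cos_sq (w * t)

theorem hasDerivAt_combination {e₁ e₂ : ℝ → ℝ} {d₁ d₂ t : ℝ} (c₁ c₂ : ℝ)
    (h₁ : HasDerivAt e₁ d₁ t) (h₂ : HasDerivAt e₂ d₂ t) :
    HasDerivAt (fun t => c₁ * e₁ t + c₂ * e₂ t) (c₁ * d₁ + c₂ * d₂) t :=
  (h₁.const_mul c₁).add (h₂.const_mul c₂)

/-- This and the next two lemmas serve the converse direction. Passing `f` through the equation `hf`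
lets `rfl` fix it from the parameters. -/
theorem exists_derivs_distinct_roots (r s c₁ c₂ : ℝ) {f : ℝ → ℝ}
    (hf : f = fun t => c₁ * Real.exp (r * t) + c₂ * Real.exp (s * t)) :
    ∃ f' : ℝ → ℝ, (∀ t, HasDerivAt f (f' t) t) ∧
      ∀ t, HasDerivAt f' ((r + s) * f' t - r * s * f t) t := by
  subst hf
  refine ⟨fun t => c₁ * (r * Real.exp (r * t)) + c₂ * (s * Real.exp (s * t)), fun t =>
    hasDerivAt_combination c₁ c₂ (hasDerivAt_exp_mul r t) (hasDerivAt_exp_mul s t), fun t =>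
    (hasDerivAt_combination c₁ c₂ ((hasDerivAt_exp_mul r t).const_mul r)
      ((hasDerivAt_exp_mul s t).const_mul s)).congr_deriv (by ring)⟩

theorem exists_derivs_double_root (r c₁ c₂ : ℝ) {f : ℝ → ℝ}
    (hf : f = fun t => c₁ * Real.exp (r * t) + c₂ * t * Real.exp (r * t)) :
    ∃ f' : ℝ → ℝ, (∀ t, HasDerivAt f (f' t) t) ∧
      ∀ t, HasDerivAt f' (2 * r * f' t - r ^ 2 * f t) t := by
  subst hf
  have h (t) : HasDerivAt (fun t => t * Real.exp (r * t))
      (Real.exp (r * t) + r * (t * Real.exp (r * t))) t :=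
    ((hasDerivAt_id t).mul (hasDerivAt_exp_mul r t)).congr_deriv (by simp only [id]; ring)
  simp only [mul_assoc]
  exact ⟨fun t => c₁ * (r * Real.exp (r * t))
      + c₂ * (Real.exp (r * t) + r * (t * Real.exp (r * t))),
    fun t => hasDerivAt_combination c₁ c₂ (hasDerivAt_exp_mul r t) (h t), fun t =>
    (hasDerivAt_combination c₁ c₂ ((hasDerivAt_exp_mul r t).const_mul r)
      ((hasDerivAt_exp_mul r t).add ((h t).const_mul r))).congr_deriv (by ring)⟩

theorem exists_derivs_complex_roots (m w c₁ c₂ : ℝ) {f : ℝ → ℝ}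
    (hf : f = fun t => c₁ * Real.exp (m * t) * Real.cos (w * t)
      + c₂ * Real.exp (m * t) * Real.sin (w * t)) :
    ∃ f' : ℝ → ℝ, (∀ t, HasDerivAt f (f' t) t) ∧
      ∀ t, HasDerivAt f' (2 * m * f' t - (m ^ 2 + w ^ 2) * f t) t := by
  subst hf
  have hC (t) : HasDerivAt (fun t => Real.exp (m * t) * Real.cos (w * t))
      (m * (Real.exp (m * t) * Real.cos (w * t)) - w * (Real.exp (m * t) * Real.sin (w * t))) t :=
    ((hasDerivAt_exp_mul m t).mul (hasDerivAt_cos_mul w t)).congr_deriv (by ring)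
  have hS (t) : HasDerivAt (fun t => Real.exp (m * t) * Real.sin (w * t))
      (m * (Real.exp (m * t) * Real.sin (w * t)) + w * (Real.exp (m * t) * Real.cos (w * t))) t :=
    ((hasDerivAt_exp_mul m t).mul (hasDerivAt_sin_mul w t)).congr_deriv (by ring)
  simp only [mul_assoc]
  exact ⟨fun t => c₁ * (m * (Real.exp (m * t) * Real.cos (w * t))
        - w * (Real.exp (m * t) * Real.sin (w * t)))
      + c₂ * (m * (Real.exp (m * t) * Real.sin (w * t))
        + w * (Real.exp (m * t) * Real.cos (w * t))),
    fun t => hasDerivAt_combination c₁ c₂ (hC t) (hS t), fun t =>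
    (hasDerivAt_combination c₁ c₂ (((hC t).const_mul m).sub ((hS t).const_mul w))
      (((hS t).const_mul m).add ((hC t).const_mul w))).congr_deriv (by ring)⟩

theorem logDeriv_eq_const_of_eq_mul_exp (hJo : IsOpen J) {φ : ℝ → ℝ} (hpos : ∀ t ∈ J, 0 < φ t)
    {c r : ℝ} (h : ∀ t ∈ J, φ t = c * Real.exp (r * t)) : ∀ t ∈ J, logDeriv φ t = r := by
  intro t ht
  have hd : HasDerivAt φ (c * (r * Real.exp (r * t))) t :=
    ((hasDerivAt_exp_mul r t).const_mul c).congr_of_eventuallyEq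
      (Filter.eventuallyEq_of_mem (hJo.mem_nhds ht) h)
  have h0 := (hpos t ht).ne'
  rw [logDeriv_apply, hd.deriv, div_eq_iff h0, h t ht]
  ring

theorem exists_eq_mul_exp_of_logDeriv_eq_const (hJo : IsOpen J) (hJ : J.OrdConnected) {φ : ℝ → ℝ}
    (hpos : ∀ t ∈ J, 0 < φ t) (hd : ∀ t ∈ J, DifferentiableAt ℝ φ t) {r : ℝ}
    (h : ∀ t ∈ J, logDeriv φ t = r) : ∃ c, ∀ t ∈ J, φ t = c * Real.exp (r * t) :=
  exists_eq_mul_exp hJo hJ fun t ht => (hd t ht).hasDerivAt.congr_deriv (by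
    rw [← h t ht, logDeriv_apply, div_mul_cancel₀ _ (hpos t ht).ne'])

/-- If `f'' = b f' - c f`, then the logarithmic derivative of `f ^ a` solves a Riccati equation. -/
theorem riccati_of_linear (hJo : IsOpen J) {φ f f' : ℝ → ℝ} {a b c : ℝ}
    (hpos : ∀ t ∈ J, 0 < f t) (hφ : ∀ t ∈ J, φ t = f t ^ a)
    (hf : ∀ t ∈ J, HasDerivAt f (f' t) t)
    (hf' : ∀ t ∈ J, HasDerivAt f' (b * f' t - c * f t) t) (ha : a ≠ 0) :
    ∀ t ∈ J, deriv (logDeriv φ) t + logDeriv φ t ^ 2 / a - b * logDeriv φ t + a * c = 0 := by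
  have hlog : ∀ t ∈ J, logDeriv φ t = a * (f' t / f t) := by
    intro t ht
    have hd : HasDerivAt φ (f' t * a * f t ^ (a - 1)) t :=
      ((hf t ht).rpow_const (Or.inl (hpos t ht).ne')).congr_of_eventuallyEq
        (Filter.eventuallyEq_of_mem (hJo.mem_nhds ht) hφ)
    have h0 := (hpos t ht).ne'
    have h1 := (Real.rpow_pos_of_pos (hpos t ht) a).ne'
    rw [logDeriv_apply, hd.deriv, hφ t ht, Real.rpow_sub_one h0]
    field_simp
  intro t ht
  have hd : HasDerivAt (logDeriv φ) _ t :=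
    (((hf' t ht).div (hf t ht) (hpos t ht).ne').const_mul a).congr_of_eventuallyEq
      (Filter.eventuallyEq_of_mem (hJo.mem_nhds ht) hlog)
  have h0 := (hpos t ht).ne'
  rw [hd.deriv, hlog t ht]
  field_simp
  ring

/-- If the logarithmic derivative of `φ` solves a Riccati equation, then `f = φ ^ q` solves a linear
equation `f'' = b f' - c f`. -/
theorem linear_of_riccati {φ : ℝ → ℝ} {q b c : ℝ}
    (hpos : ∀ t ∈ J, 0 < φ t) (hd : ∀ t ∈ J, DifferentiableAt ℝ φ t)
    (hl : ∀ t ∈ J, DifferentiableAt ℝ (logDeriv φ) t)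
    (h : ∀ t ∈ J, q * deriv (logDeriv φ) t + q ^ 2 * logDeriv φ t ^ 2 - b * q * logDeriv φ t + c = 0) :
    (∀ t ∈ J, HasDerivAt (fun t => φ t ^ q) (q * logDeriv φ t * φ t ^ q) t) ∧
    ∀ t ∈ J, HasDerivAt (fun t => q * logDeriv φ t * φ t ^ q)
      (b * (q * logDeriv φ t * φ t ^ q) - c * φ t ^ q) t := by
  have h1 : ∀ t ∈ J, HasDerivAt (fun t => φ t ^ q) (q * logDeriv φ t * φ t ^ q) t := by
    intro t ht
    have h0 := (hpos t ht).ne'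
    refine ((hd t ht).hasDerivAt.rpow_const (Or.inl h0)).congr_deriv ?_
    rw [logDeriv_apply, Real.rpow_sub_one h0]
    field_simp
  refine ⟨h1, fun t ht => ?_⟩
  refine (((hl t ht).hasDerivAt.const_mul q).mul (h1 t ht)).congr_deriv ?_
  linear_combination φ t ^ q * h t ht

end Equations

theorem differentiableAt_logDeriv {U : Set ℝ} (hU : IsOpen U) {f : ℝ → ℝ}
    (hf : ContDiffOn ℝ ∞ f U) {t : ℝ} (ht : t ∈ U) (h0 : f t ≠ 0) :
    DifferentiableAt ℝ (logDeriv f) t := by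
  have h1 : DifferentiableAt ℝ f t :=
    (hf.contDiffAt (hU.mem_nhds ht)).differentiableAt (by simp)
  have h2 : DifferentiableAt ℝ (deriv f) t :=
    (((contDiffOn_infty_iff_deriv_of_isOpen hU).1 hf).2.contDiffAt
      (hU.mem_nhds ht)).differentiableAt (by simp)
  exact h2.div h1 h0

/-! ### Scalar curvature of the Kasner metric -/

section Curvature

variable (J : TopologicalSpace.Opens ℝ) {F₁ F₂ F₃ : Type*}
  [TopologicalSpace F₁] [ChartedSpace ℝ F₁] [TopologicalSpace F₂] [ChartedSpace ℝ F₂]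
  [TopologicalSpace F₃] [ChartedSpace ℝ F₃]
  [IsManifold 𝓘(ℝ, ℝ) ∞ F₁] [IsManifold 𝓘(ℝ, ℝ) ∞ F₂] [IsManifold 𝓘(ℝ, ℝ) ∞ F₃]

theorem eventually_hasDerivAt_fibreCoeff {F : Type*} [TopologicalSpace F] [ChartedSpace ℝ F]
    [IsManifold 𝓘(ℝ, ℝ) ∞ F] (g : FibreMetric F) (x : F) :
    ∀ᶠ s in nhds (extChartAt 𝓘(ℝ, ℝ) x x), fibreCoeff g x s ≠ 0 ∧ HasDerivAt (fibreCoeff g x)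
      (2 * (1 / 2 * logDeriv (fibreCoeff g x) s) * fibreCoeff g x s) s := by
  filter_upwards [(isOpen_extChartAt_target x).mem_nhds (mem_extChartAt_target x)] with s hs
  have h0 := (fibreCoeff_pos g hs).ne'
  refine ⟨h0, ((((contDiffOn_fibreCoeff g x).contDiffAt
    ((isOpen_extChartAt_target x).mem_nhds hs)).differentiableAt
      (by simp)).hasDerivAt).congr_deriv ?_⟩
  rw [logDeriv_apply]
  field_simp

theorem hasDerivAt_half_logDeriv_fibreCoeff {F : Type*} [TopologicalSpace F] [ChartedSpace ℝ F]
    [IsManifold 𝓘(ℝ, ℝ) ∞ F] (g : FibreMetric F) (x : F) :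
    HasDerivAt (fun s => 1 / 2 * logDeriv (fibreCoeff g x) s)
      (1 / 2 * deriv (logDeriv (fibreCoeff g x)) (extChartAt 𝓘(ℝ, ℝ) x x))
      (extChartAt 𝓘(ℝ, ℝ) x x) :=
  (differentiableAt_logDeriv (isOpen_extChartAt_target x) (contDiffOn_fibreCoeff g x)
    (mem_extChartAt_target x) (fibreCoeff_pos g (mem_extChartAt_target x)).ne').hasDerivAt.const_mul _

theorem eventually_hasDerivAt_rpow_sq {φ : ℝ → ℝ} (hφ : ContDiffOn ℝ ∞ φ J)
    (hφpos : ∀ t ∈ J, 0 < φ t) (p : ℝ) {t : ℝ} (ht : t ∈ J) :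
    ∀ᶠ s in nhds t, (φ s ^ p) ^ 2 ≠ 0 ∧ HasDerivAt (fun s => (φ s ^ p) ^ 2)
      (2 * (p * logDeriv φ s) * (φ s ^ p) ^ 2) s := by
  filter_upwards [J.isOpen.mem_nhds ht] with s hs
  have h0 := (hφpos s hs).ne'
  refine ⟨pow_ne_zero 2 (Real.rpow_pos_of_pos (hφpos s hs) p).ne', ?_⟩
  have hd := ((hφ.contDiffAt (J.isOpen.mem_nhds hs)).differentiableAt (by simp)).hasDerivAt
  refine ((hd.rpow_const (p := p) (Or.inl h0)).pow 2).congr_deriv ?_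
  rw [logDeriv_apply, Real.rpow_sub_one h0]
  field_simp
  norm_num
  ring

/-- This is `scalarCurvatureAt_warped` with `hᵢ = pᵢ H`, `H = logDeriv φ`; the mixed products
combine through `2(p₁p₂ + p₁p₃ + p₂p₃) = ζ² - η`. -/
theorem quarterSymmetricScalarCurvature_kasner (g₁ : FibreMetric F₁) (g₂ : FibreMetric F₂)
    (g₃ : FibreMetric F₃) {φ : ℝ → ℝ} (hφ : ContDiffOn ℝ ∞ φ J) (hφpos : ∀ t ∈ J, 0 < φ t)
    (p₁ p₂ p₃ lam₁ lam₂ : ℝ) (x : J × F₁ × F₂ × F₃) :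
    quarterSymmetricScalarCurvature prodModel (kasnerMetric J φ p₁ p₂ p₃ g₁ g₂ g₃)
        (dtField J) lam₁ lam₂ x =
      -2 * (p₁ + p₂ + p₃) * deriv (logDeriv φ) x.1
        - ((p₁ ^ 2 + p₂ ^ 2 + p₃ ^ 2) + (p₁ + p₂ + p₃) ^ 2) * logDeriv φ x.1 ^ 2
        + 3 * (lam₁ + lam₂) * (p₁ + p₂ + p₃) * logDeriv φ x.1
        + 3 * (lam₁ ^ 2 + lam₂ ^ 2 - 4 * lam₁ * lam₂) := by
  have hx : ∀ᶠ y in nhds (extChartAt prodModel x x), y ∈ (extChartAt prodModel x).target :=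
    (isOpen_extChartAt_target x).mem_nhds (mem_extChartAt_target x)
  have hG : metricInChart prodModel (kasnerMetric J φ p₁ p₂ p₃ g₁ g₂ g₃) x
      =ᶠ[nhds (extChartAt prodModel x x)] fun y =>
        diagForm ((φ y.1 ^ p₁) ^ 2 * fibreCoeff g₁ x.2.1 (coordX y))
        ((φ y.1 ^ p₂) ^ 2 * fibreCoeff g₂ x.2.2.1 (coordY y))
        ((φ y.1 ^ p₃) ^ 2 * fibreCoeff g₃ x.2.2.2 (coordZ y)) := by
    filter_upwards [hx] with y hy
    exact metricInChart_multiplyWarpedMetric J (fun t => φ t ^ p₁) (fun t => φ t ^ p₂)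
      (fun t => φ t ^ p₃) g₁ g₂ g₃ hy
  have hP : fieldInChart prodModel (dtField J) x
      =ᶠ[nhds (extChartAt prodModel x x)] fun _ => (1, 0, 0, 0) := by
    filter_upwards [hx] with y hy
    exact fieldInChart_dtField J hy
  have hl : HasDerivAt (logDeriv φ) (deriv (logDeriv φ) x.1) x.1 :=
    (differentiableAt_logDeriv J.isOpen hφ x.1.2 (hφpos _ x.1.2).ne').hasDerivAt
  have key := scalarCurvatureAt_warped (β₁ := fun s => (φ s ^ p₁) ^ 2)
    (β₂ := fun s => (φ s ^ p₂) ^ 2) (β₃ := fun s => (φ s ^ p₃) ^ 2)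
    (h₁ := fun s => p₁ * logDeriv φ s) (h₂ := fun s => p₂ * logDeriv φ s)
    (h₃ := fun s => p₃ * logDeriv φ s) lam₁ lam₂ hG hP
    (eventually_hasDerivAt_rpow_sq J hφ hφpos p₁ x.1.2)
    (eventually_hasDerivAt_rpow_sq J hφ hφpos p₂ x.1.2)
    (eventually_hasDerivAt_rpow_sq J hφ hφpos p₃ x.1.2)
    (eventually_hasDerivAt_fibreCoeff g₁ x.2.1) (eventually_hasDerivAt_fibreCoeff g₂ x.2.2.1)
    (eventually_hasDerivAt_fibreCoeff g₃ x.2.2.2) (hl.const_mul p₁) (hl.const_mul p₂)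
    (hl.const_mul p₃) (hasDerivAt_half_logDeriv_fibreCoeff g₁ x.2.1)
    (hasDerivAt_half_logDeriv_fibreCoeff g₂ x.2.2.1)
    (hasDerivAt_half_logDeriv_fibreCoeff g₃ x.2.2.2)
  refine key.trans ?_
  change -2 * (p₁ * deriv (logDeriv φ) x.1 + (p₁ * logDeriv φ x.1) ^ 2
    + p₂ * deriv (logDeriv φ) x.1 + (p₂ * logDeriv φ x.1) ^ 2
    + p₃ * deriv (logDeriv φ) x.1 + (p₃ * logDeriv φ x.1) ^ 2)
    - 2 * ((p₁ * logDeriv φ x.1) * (p₂ * logDeriv φ x.1)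
      + (p₁ * logDeriv φ x.1) * (p₃ * logDeriv φ x.1)
      + (p₂ * logDeriv φ x.1) * (p₃ * logDeriv φ x.1))
    + 3 * (lam₁ + lam₂) * (p₁ * logDeriv φ x.1 + p₂ * logDeriv φ x.1 + p₃ * logDeriv φ x.1)
    + 3 * (lam₁ ^ 2 + lam₂ ^ 2 - 4 * lam₁ * lam₂) = _
  ring

end Curvature

/-! ### Solving the constant curvature equation -/

section Classification

variable {J : Set ℝ}

theorem constant_scalar_iff_of_sum_zero (hJo : IsOpen J) (hJ : J.OrdConnected) (hJne : J.Nonempty)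
    {φ : ℝ → ℝ} (hφpos : ∀ t ∈ J, 0 < φ t) (hd : ∀ t ∈ J, DifferentiableAt ℝ φ t)
    (hl : ∀ t ∈ J, DifferentiableAt ℝ (logDeriv φ) t) {η K S : ℝ} (hη : 0 < η) :
    (∀ t ∈ J, K - η * logDeriv φ t ^ 2 = S) ↔
      (S > K → False) ∧
       (S = K → ∃ c : ℝ, ∀ t ∈ J, φ t = c) ∧
       (S < K → ∃ c₀ : ℝ,
         (∀ t ∈ J, φ t = c₀ * Real.exp (√((K - S) / η) * t)) ∨
         (∀ t ∈ J, φ t = c₀ * Real.exp (-√((K - S) / η) * t))) := by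
  constructor
  · intro h
    refine ⟨fun hS => ?_, fun hS => ?_, fun hS => ?_⟩
    · obtain ⟨t, ht⟩ := hJne
      nlinarith [h t ht, mul_nonneg hη.le (sq_nonneg (logDeriv φ t))]
    · have h0 : ∀ t ∈ J, logDeriv φ t = 0 := fun t ht => by
        have : η * logDeriv φ t ^ 2 = 0 := by linarith [h t ht]
        simpa [hη.ne'] using this
      obtain ⟨c, hc⟩ := exists_eq_mul_exp_of_logDeriv_eq_const hJo hJ hφpos hd h0
      exact ⟨c, fun t ht => by simpa using hc t ht⟩
    · have hr : 0 < (K - S) / η := div_pos (by linarith) hη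
      have hsq : Set.EqOn (logDeriv φ ^ 2) ((fun _ => √((K - S) / η)) ^ 2) J := fun t ht => by
        simp only [Pi.pow_apply, Real.sq_sqrt hr.le]
        rw [eq_div_iff hη.ne']
        linarith [h t ht]
      -- A continuous function on an interval whose square is a positive constant cannot change
      -- sign, so one sign serves all of `J`.
      rcases hJ.isPreconnected.eq_or_eq_neg_of_sq_eq
        (fun t ht => (hl t ht).continuousAt.continuousWithinAt) continuousOn_const hsq
        (fun _ => (Real.sqrt_pos.2 hr).ne') with h' | h'
      · obtain ⟨c, hc⟩ := exists_eq_mul_exp_of_logDeriv_eq_const hJo hJ hφpos hd h'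
        exact ⟨c, Or.inl hc⟩
      · obtain ⟨c, hc⟩ := exists_eq_mul_exp_of_logDeriv_eq_const hJo hJ hφpos hd
          (r := -√((K - S) / η)) h'
        exact ⟨c, Or.inr hc⟩
  · rintro ⟨h₁, h₂, h₃⟩ t ht
    rcases lt_trichotomy S K with hS | hS | hS
    · have hr : 0 < (K - S) / η := div_pos (by linarith) hη
      have hsq : logDeriv φ t ^ 2 = (K - S) / η := by
        obtain ⟨c, hc | hc⟩ := h₃ hS <;>
        rw [logDeriv_eq_const_of_eq_mul_exp hJo hφpos hc t ht]
        · exact Real.sq_sqrt hr.le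
        · rw [neg_sq, Real.sq_sqrt hr.le]
      rw [hsq]
      field_simp
      ring
    · obtain ⟨c, hc⟩ := h₂ hS
      rw [logDeriv_eq_const_of_eq_mul_exp (c := c) (r := 0) hJo hφpos
        (fun t ht => by simpa using hc t ht) t ht, hS]
      ring
    · exact (h₁ hS).elim

theorem constant_scalar_iff_of_sum_ne_zero (hJo : IsOpen J) (hJ : J.OrdConnected)
    {φ : ℝ → ℝ} (hφpos : ∀ t ∈ J, 0 < φ t) (hd : ∀ t ∈ J, DifferentiableAt ℝ φ t)
    (hl : ∀ t ∈ J, DifferentiableAt ℝ (logDeriv φ) t) {ζ η K S L : ℝ} (hη : 0 ≤ η) (hζ : ζ ≠ 0) :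
    (∀ t ∈ J, -2 * ζ * deriv (logDeriv φ) t - (η + ζ ^ 2) * logDeriv φ t ^ 2
      + 3 * L * ζ * logDeriv φ t + K = S) ↔
    ∃ ψ : ℝ → ℝ,
       (∀ t ∈ J, 0 < ψ t ∧ φ t = ψ t ^ (2 * ζ / (η + ζ ^ 2))) ∧
       ((S < 9 * ζ ^ 2 * L ^ 2 / (4 * (η + ζ ^ 2)) + K ∧
          ∃ c₁ c₂ : ℝ, ∀ t ∈ J, ψ t =
            c₁ * Real.exp ((3 / 2 * L +
              √(9 * L ^ 2 / 4 - (S - K) * (η + ζ ^ 2) / ζ ^ 2)) / 2 * t) +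
            c₂ * Real.exp ((3 / 2 * L -
              √(9 * L ^ 2 / 4 - (S - K) * (η + ζ ^ 2) / ζ ^ 2)) / 2 * t)) ∨
        (S = 9 * ζ ^ 2 * L ^ 2 / (4 * (η + ζ ^ 2)) + K ∧
          ∃ c₁ c₂ : ℝ, ∀ t ∈ J, ψ t =
            c₁ * Real.exp (3 * L / 4 * t) +
            c₂ * t * Real.exp (3 * L / 4 * t)) ∨
        (S > 9 * ζ ^ 2 * L ^ 2 / (4 * (η + ζ ^ 2)) + K ∧
          ∃ c₁ c₂ : ℝ, ∀ t ∈ J, ψ t =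
            c₁ * Real.exp (3 / 4 * L * t) *
              Real.cos (√((S - K) * (η + ζ ^ 2) / ζ ^ 2 - 9 * L ^ 2 / 4) / 2 * t) +
            c₂ * Real.exp (3 / 4 * L * t) *
              Real.sin (√((S - K) * (η + ζ ^ 2) / ζ ^ 2 - 9 * L ^ 2 / 4) / 2 * t))) := by
  have hpos : 0 < η + ζ ^ 2 := by positivity
  have hne := hpos.ne'
  set T := 9 * ζ ^ 2 * L ^ 2 / (4 * (η + ζ ^ 2)) + K with hT
  set D := 9 * L ^ 2 / 4 - (S - K) * (η + ζ ^ 2) / ζ ^ 2 with hD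
  have hD' : (S - K) * (η + ζ ^ 2) / ζ ^ 2 - 9 * L ^ 2 / 4 = -D := by rw [hD]; ring
  -- This is why the threshold `T` decides the case: `D` and `T - S` have the same sign.
  have hDT : D = (η + ζ ^ 2) / ζ ^ 2 * (T - S) := by
    rw [hD, hT]
    field_simp
    ring
  have hfac : 0 < (η + ζ ^ 2) / ζ ^ 2 := by positivity
  rw [hD']
  -- The roots are those of `r² - (3/2) L r + C`, whose discriminant `9L²/4 - 4C` is `D`.
  set C := (S - K) * (η + ζ ^ 2) / (4 * ζ ^ 2) with hC
  have hCD : C = (9 * L ^ 2 / 4 - D) / 4 := by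
    rw [hC, hD]
    field_simp
    ring
  constructor
  · intro h
    -- The reciprocal of the exponent in the statement, and the power for which the quadratic term
    -- becomes `q² H²`, as linearisation requires.
    set q := (η + ζ ^ 2) / (2 * ζ) with hq
    obtain ⟨d₁, d₂⟩ := linear_of_riccati (q := q) (b := 3 / 2 * L) (c := C) hφpos hd hl
      fun t ht => by
        rw [hC, hq, ← h t ht]
        field_simp
        ring
    refine ⟨fun t => φ t ^ q, fun t ht => ⟨Real.rpow_pos_of_pos (hφpos t ht) q, ?_⟩, ?_⟩
    · have hq1 : q * (2 * ζ / (η + ζ ^ 2)) = 1 := by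
        rw [hq]
        field_simp
      rw [← Real.rpow_mul (hφpos t ht).le, hq1, Real.rpow_one]
    rcases lt_trichotomy S T with hS | hS | hS
    · have hDpos : 0 < D := by
        rw [hDT]
        exact mul_pos hfac (by linarith)
      have hs := Real.sq_sqrt hDpos.le
      refine Or.inl ⟨hS, exists_eq_of_distinct_roots hJo hJ ?_ d₁
        fun t ht => (d₂ t ht).congr_deriv ?_⟩
      · have := Real.sqrt_pos.2 hDpos
        intro h'
        linarith
      · rw [hCD]
        linear_combination -(1 / 4) * φ t ^ q * hs
    · have hD0 : D = 0 := by rw [hDT, hS]; ring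
      refine Or.inr (Or.inl ⟨hS, exists_eq_of_double_root hJo hJ d₁
        fun t ht => (d₂ t ht).congr_deriv ?_⟩)
      rw [hCD, hD0]
      ring
    · have hDneg : 0 < -D := by
        rw [hDT, ← mul_neg]
        exact mul_pos hfac (by linarith)
      have hs := Real.sq_sqrt hDneg.le
      refine Or.inr (Or.inr ⟨hS, exists_eq_of_complex_roots hJo hJ ?_ d₁
        fun t ht => (d₂ t ht).congr_deriv ?_⟩)
      · have := Real.sqrt_pos.2 hDneg
        positivity
      · rw [hCD]
        linear_combination (1 / 4) * φ t ^ q * hs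
  · rintro ⟨ψ, hψ, hcases⟩
    -- Since `ψ` is prescribed only on `J`, the argument uses the closed form `f`, which solves the
    -- linear equation on all of `ℝ`.
    have main {f f' : ℝ → ℝ} (hψf : ∀ t ∈ J, ψ t = f t) (hf : ∀ t, HasDerivAt f (f' t) t)
        (hf' : ∀ t, HasDerivAt f' (3 / 2 * L * f' t - C * f t) t) :
        ∀ t ∈ J, -2 * ζ * deriv (logDeriv φ) t - (η + ζ ^ 2) * logDeriv φ t ^ 2
          + 3 * L * ζ * logDeriv φ t + K = S := by
      intro t ht
      have ha : 2 * ζ / (η + ζ ^ 2) ≠ 0 := by positivity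
      have h := riccati_of_linear (φ := φ) hJo (fun t ht => hψf t ht ▸ (hψ t ht).1)
        (fun t ht => hψf t ht ▸ (hψ t ht).2) (fun t _ => hf t) (fun t _ => hf' t) ha t ht
      rw [hC] at h
      field_simp at h
      linear_combination -(1 / 4) * h
    rcases hcases with ⟨hS, c₁, c₂, hc⟩ | ⟨hS, c₁, c₂, hc⟩ | ⟨hS, c₁, c₂, hc⟩
    · have hDpos : 0 < D := by
        rw [hDT]
        exact mul_pos hfac (by linarith)
      have hs := Real.sq_sqrt hDpos.le
      obtain ⟨f', h₁, h₂⟩ := exists_derivs_distinct_roots ((3 / 2 * L + √D) / 2)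
        ((3 / 2 * L - √D) / 2) c₁ c₂ rfl
      refine main hc h₁ fun t => (h₂ t).congr_deriv ?_
      rw [show C = (9 * L ^ 2 / 4 - √D ^ 2) / 4 by rw [hs, hCD]]
      ring
    · have hD0 : D = 0 := by rw [hDT, hS]; ring
      obtain ⟨f', h₁, h₂⟩ := exists_derivs_double_root (3 * L / 4) c₁ c₂ rfl
      refine main hc h₁ fun t => (h₂ t).congr_deriv ?_
      rw [hCD, hD0]
      ring
    · have hDneg : 0 < -D := by
        rw [hDT, ← mul_neg]
        exact mul_pos hfac (by linarith)
      have hs := Real.sq_sqrt hDneg.le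
      obtain ⟨f', h₁, h₂⟩ := exists_derivs_complex_roots (3 / 4 * L) (√(-D) / 2) c₁ c₂ rfl
      refine main hc h₁ fun t => (h₂ t).congr_deriv ?_
      rw [show C = (9 * L ^ 2 / 4 + √(-D) ^ 2) / 4 by rw [hs, hCD]; ring]
      ring

end Classification

end

/-! ### Assembly of the three cases -/

theorem theorem4p21 (J : TopologicalSpace.Opens ℝ)
    (hJ : (J : Set ℝ).OrdConnected) (hJne : (J : Set ℝ).Nonempty)
    {F₁ F₂ F₃ : Type*}
    [TopologicalSpace F₁] [ChartedSpace ℝ F₁] [IsManifold 𝓘(ℝ, ℝ) ∞ F₁] [Nonempty F₁]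
    [TopologicalSpace F₂] [ChartedSpace ℝ F₂] [IsManifold 𝓘(ℝ, ℝ) ∞ F₂] [Nonempty F₂]
    [TopologicalSpace F₃] [ChartedSpace ℝ F₃] [IsManifold 𝓘(ℝ, ℝ) ∞ F₃] [Nonempty F₃]
    (g₁ : FibreMetric F₁) (g₂ : FibreMetric F₂) (g₃ : FibreMetric F₃)
    (φ : ℝ → ℝ) (hφ : ContDiffOn ℝ ∞ φ J) (hφpos : ∀ t ∈ J, 0 < φ t)
    (p₁ p₂ p₃ lam₁ lam₂ : ℝ) (hlam₁ : lam₁ ≠ 0) (hlam₂ : lam₂ ≠ 0)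
    (ζ η K S : ℝ) (hζ : ζ = p₁ + p₂ + p₃) (hη : η = p₁ ^ 2 + p₂ ^ 2 + p₃ ^ 2)
    (hK : K = 3 * (lam₁ ^ 2 + lam₂ ^ 2 - 4 * lam₁ * lam₂)) :
    (∀ x : J × F₁ × F₂ × F₃,
      quarterSymmetricScalarCurvature prodModel (kasnerMetric J φ p₁ p₂ p₃ g₁ g₂ g₃)
        (dtField J) lam₁ lam₂ x = S) ↔
    ((ζ = 0 ∧ η = 0 ∧ S = K) ∨
     (ζ = 0 ∧ η ≠ 0 ∧
       (S > K → False) ∧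
       (S = K → ∃ c : ℝ, ∀ t ∈ J, φ t = c) ∧
       (S < K → ∃ c₀ : ℝ,
         (∀ t ∈ J, φ t = c₀ * Real.exp (√((K - S) / η) * t)) ∨
         (∀ t ∈ J, φ t = c₀ * Real.exp (-√((K - S) / η) * t)))) ∨
     (ζ ≠ 0 ∧ ∃ ψ : ℝ → ℝ,
       (∀ t ∈ J, 0 < ψ t ∧ φ t = ψ t ^ (2 * ζ / (η + ζ ^ 2))) ∧
       ((S < 9 * ζ ^ 2 * (lam₁ + lam₂) ^ 2 / (4 * (η + ζ ^ 2)) + K ∧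
          ∃ c₁ c₂ : ℝ, ∀ t ∈ J, ψ t =
            c₁ * Real.exp ((3 / 2 * (lam₁ + lam₂) +
              √(9 * (lam₁ + lam₂) ^ 2 / 4 - (S - K) * (η + ζ ^ 2) / ζ ^ 2)) / 2 * t) +
            c₂ * Real.exp ((3 / 2 * (lam₁ + lam₂) -
              √(9 * (lam₁ + lam₂) ^ 2 / 4 - (S - K) * (η + ζ ^ 2) / ζ ^ 2)) / 2 * t)) ∨
        (S = 9 * ζ ^ 2 * (lam₁ + lam₂) ^ 2 / (4 * (η + ζ ^ 2)) + K ∧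
          ∃ c₁ c₂ : ℝ, ∀ t ∈ J, ψ t =
            c₁ * Real.exp (3 * (lam₁ + lam₂) / 4 * t) +
            c₂ * t * Real.exp (3 * (lam₁ + lam₂) / 4 * t)) ∨
        (S > 9 * ζ ^ 2 * (lam₁ + lam₂) ^ 2 / (4 * (η + ζ ^ 2)) + K ∧
          ∃ c₁ c₂ : ℝ, ∀ t ∈ J, ψ t =
            c₁ * Real.exp (3 / 4 * (lam₁ + lam₂) * t) *
              Real.cos (√((S - K) * (η + ζ ^ 2) / ζ ^ 2 - 9 * (lam₁ + lam₂) ^ 2 / 4) / 2 * t) +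
            c₂ * Real.exp (3 / 4 * (lam₁ + lam₂) * t) *
              Real.sin (√((S - K) * (η + ζ ^ 2) / ζ ^ 2 - 9 * (lam₁ + lam₂) ^ 2 / 4) / 2 * t))))) := by
  have hd : ∀ t ∈ J, DifferentiableAt ℝ φ t := fun t ht =>
    (hφ.contDiffAt (J.isOpen.mem_nhds ht)).differentiableAt (by simp)
  have hl : ∀ t ∈ J, DifferentiableAt ℝ (logDeriv φ) t := fun t ht =>
    differentiableAt_logDeriv J.isOpen hφ ht (hφpos t ht).ne'
  have hη0 : 0 ≤ η := by rw [hη]; positivity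
  have hcurv : (∀ x : J × F₁ × F₂ × F₃,
      quarterSymmetricScalarCurvature prodModel (kasnerMetric J φ p₁ p₂ p₃ g₁ g₂ g₃)
        (dtField J) lam₁ lam₂ x = S) ↔
      ∀ t ∈ (J : Set ℝ), -2 * ζ * deriv (logDeriv φ) t - (η + ζ ^ 2) * logDeriv φ t ^ 2
        + 3 * (lam₁ + lam₂) * ζ * logDeriv φ t + K = S := by
    simp only [quarterSymmetricScalarCurvature_kasner J g₁ g₂ g₃ hφ hφpos, ← hζ, ← hη, ← hK]
    -- The curvature depends on `x` through `t` alone, and nonempty fibres provide a point over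
    -- every `t`.
    refine ⟨fun h t ht => h (⟨t, ht⟩, Classical.arbitrary F₁, Classical.arbitrary F₂,
      Classical.arbitrary F₃), fun h x => h x.1 x.1.2⟩
  rw [hcurv]
  by_cases hζ0 : ζ = 0
  · rw [hζ0]
    by_cases hη1 : η = 0
    -- With `ζ = η = 0` every term containing `φ` vanishes, and evaluation at a single `t` gives `S
    -- = K`.
    · obtain ⟨t, ht⟩ := hJne
      rw [hη1]
      constructor
      · intro h
        exact Or.inl ⟨rfl, rfl, by simpa using (h t ht).symm⟩
      · rintro (⟨-, -, h⟩ | ⟨-, h, -⟩ | ⟨h, -⟩)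
        · intro s _
          rw [h]
          ring
        · exact (h rfl).elim
        · exact (h rfl).elim
    · have key := constant_scalar_iff_of_sum_zero (K := K) (S := S) J.isOpen hJ hJne hφpos hd hl
        (lt_of_le_of_ne hη0 (Ne.symm hη1))
      have he : (∀ t ∈ (J : Set ℝ), -2 * (0 : ℝ) * deriv (logDeriv φ) t
          - (η + 0 ^ 2) * logDeriv φ t ^ 2 + 3 * (lam₁ + lam₂) * 0 * logDeriv φ t + K = S) ↔
          ∀ t ∈ (J : Set ℝ), K - η * logDeriv φ t ^ 2 = S :=
        forall₂_congr fun t _ => by ring_nf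
      rw [he, key]
      constructor
      · exact fun h => Or.inr (Or.inl ⟨rfl, hη1, h⟩)
      · rintro (⟨-, h, -⟩ | ⟨-, -, h⟩ | ⟨h, -⟩)
        · exact (hη1 h).elim
        · exact h
        · exact (h rfl).elim
  · have key := constant_scalar_iff_of_sum_ne_zero (K := K) (S := S) (L := lam₁ + lam₂) J.isOpen hJ
      hφpos hd hl hη0 hζ0
    rw [key]
    constructor
    · exact fun h => Or.inr (Or.inr ⟨hζ0, h⟩)
    · rintro (⟨h, -⟩ | ⟨h, -⟩ | ⟨-, h⟩)
      · exact (hζ0 h).elim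
      · exact (hζ0 h).elim
      · exact h
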